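/- A row-standard tableau is a numbering of the boxes of a Young diagram with $n$ boxes by $1,\dots,n$ (each number used once) that increases along every row; it is standard if it also increases down every column. Write $\mathrm{sh}(\tau)$ for the shape and $|\tau|$ for the number of boxes of a tableau $\tau$. Let $\mathbf Y$ be the set of pairs $(\tau,T)$ with $\tau$ row-standard, $T$ standard and $\mathrm{sh}(\tau)=\mathrm{sh}(T)$. For $T$ standard with $|T|=n$ and $u:\mathbb C^n\to\mathbb C^n$ nilpotent such that the Young diagram $Y(u)$, whose row lengths are the sizes of the Jordan blocks of $u$, equals $\mathrm{sh}(T)$, let $\mathcal B_u$ be the Springer fiber, i.e. the variety of complete flags $(0=V_0\subset V_1\subset\dots\subset V_n=\mathbb C^n)$ with $u(V_i)\subseteq V_i$ for all $i$. Let $\mathcal B_u^T\subseteq\mathcal B_u$ be the set of those flags for which, for every $i=1,\dots,n$, $Y(u|_{V_i})$ is the shape of the subtableau of $T$ formed by the entries $1,\dots,i$, and let $\mathcal K^T$ be the Zariski closure of $\mathcal B_u^T$ in $\mathcal B_u$. Let $(e_x)$ be a Jordan basis of $u$ indexed by the boxes $x$ of $\mathrm{sh}(T)$, so that $u(e_x)=0$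 if $x$ lies in the first column and otherwise $u(e_x)=e_{x'}$, where $x'$ is the box just to the left of $x$. For $\tau$ row-standard of shape $\mathrm{sh}(T)$, let $F_\tau\in\mathcal B_u$ be the flag with $V_i=\langle e_{x_1},\dots,e_{x_i}\rangle$, where $x_j$ is the box of $\tau$ containing $j$. Write $\tau\in T$ if $F_\tau\in\mathcal K^T$ for every such $u$ and every such Jordan basis (this does not depend on the choice of $u$ and of the basis). For standard tableaux, $T'\subseteq T$ means that $T'$ is obtained from $T$ by deleting the entries $i,\dots,|T|$ for some $i\ge1$ (possibly none, or all of them). For row-standard tableaux, $\tau'\subseteq\tau$ means that $|\tau'|\le|\tau|$ and that any two entries of $\tau'$ lie in the same row of $\tau'$ if and only if they lie in the same row of $\tau$. **Theorem.** Let $(\tau,T),(\tau',T')\in\mathbf Y$ with $\tau'\subseteq\tau$ and $T'\subseteq T$. (a) If $\tau\in T$, then $\tau'\in T'$. (b) If moreover every $i\in\{|T'|+1,\dots,|T|\}$ lies in the same column of $\tau$ as of $T$, then $\tau\in T$ if and only if $\tau'\in T'$. -/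

import Mathlib

noncomputable section

namespace Springer

open scoped Topology

/-! ### Tableaux

A box of a Young diagram is a pair `(row, column)`, both counted from `0`. The entries
`1, …, n` of a tableau with `n` boxes are represented by the elements `0, …, n - 1` of `Fin n`. -/

/-- A row-standard tableau of shape `μ`: a numbering of the boxes of `μ` by `1, …, |μ|` that
increases along the rows. -/
structure RowStandardTableau (μ : YoungDiagram) where
  /-- the number written in a box -/
  entry : μ.cells ≃ Fin μ.card
  row_strict : ∀ c d : μ.cells, c.1.1 = d.1.1 → c.1.2 < d.1.2 → entry c < entry d

/-- A standard tableau: the numbering increases along the rows and down the columns. -/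
structure StandardTableau (μ : YoungDiagram) extends RowStandardTableau μ where
  col_strict : ∀ c d : μ.cells, c.1.2 = d.1.2 → c.1.1 < d.1.1 → entry c < entry d

variable {μ μ' : YoungDiagram}

/-- The row containing a given entry. -/
def RowStandardTableau.rowOf (τ : RowStandardTableau μ) (i : Fin μ.card) : ℕ :=
  (τ.entry.symm i).1.1

/-- The column containing a given entry. -/
def RowStandardTableau.colOf (τ : RowStandardTableau μ) (i : Fin μ.card) : ℕ :=
  (τ.entry.symm i).1.2

/-- `τ' ⊆ τ` for row-standard tableaux: `|τ'| ≤ |τ|`, and two entries of `τ'` lie in the same row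
of `τ'` if and only if they lie in the same row of `τ`. -/
def RowStandardTableau.IsSubtableau (τ' : RowStandardTableau μ') (τ : RowStandardTableau μ) :
    Prop :=
  ∃ h : μ'.card ≤ μ.card, ∀ i j : Fin μ'.card,
    τ'.rowOf i = τ'.rowOf j ↔ τ.rowOf (Fin.castLE h i) = τ.rowOf (Fin.castLE h j)

/-- `T' ⊆ T` for standard tableaux: `T'` is obtained from `T` by deleting all entries larger than
some `m`, the remaining entries staying in their boxes. -/
def StandardTableau.IsSubtableau (T' : StandardTableau μ') (T : StandardTableau μ) : Prop :=
  ∃ m : ℕ, (∀ c : ℕ × ℕ, c ∈ μ'.cells ↔ ∃ h : c ∈ μ.cells, (T.entry ⟨c, h⟩ : ℕ) < m) ∧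
    ∀ (c : ℕ × ℕ) (h' : c ∈ μ'.cells) (h : c ∈ μ.cells),
      (T'.entry ⟨c, h'⟩ : ℕ) = T.entry ⟨c, h⟩

theorem StandardTableau.entry_mono (T : StandardTableau μ) {c d : μ.cells}
    (h : c.1 ≤ d.1) : T.entry c ≤ T.entry d := by
  have hmem : (d.1.1, c.1.2) ∈ μ.cells :=
    μ.isLowerSet (show (d.1.1, c.1.2) ≤ d.1 from ⟨le_rfl, h.2⟩) d.2
  have h1 : T.entry c ≤ T.entry ⟨(d.1.1, c.1.2), hmem⟩ := by
    rcases h.1.eq_or_lt with he | hl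
    · have : c = ⟨(d.1.1, c.1.2), hmem⟩ := Subtype.ext (Prod.ext he rfl)
      exact (congrArg T.entry this).le
    · exact (T.col_strict c ⟨(d.1.1, c.1.2), hmem⟩ rfl hl).le
  have h2 : T.entry ⟨(d.1.1, c.1.2), hmem⟩ ≤ T.entry d := by
    rcases h.2.eq_or_lt with he | hl
    · have : (⟨(d.1.1, c.1.2), hmem⟩ : μ.cells) = d := Subtype.ext (Prod.ext rfl he)
      exact (congrArg T.entry this).le
    · exact (T.row_strict ⟨(d.1.1, c.1.2), hmem⟩ d rfl hl).le
  exact h1.trans h2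

/-- The shape of the subtableau of `T` formed by the entries `1, …, i`. -/
def StandardTableau.shapeUpTo (T : StandardTableau μ) (i : ℕ) : YoungDiagram where
  cells := (Finset.univ.filter fun c : μ.cells => (T.entry c : ℕ) < i).map
    (Function.Embedding.subtype _)
  isLowerSet := by
    intro a b hba ha
    simp only [Finset.coe_map, Function.Embedding.subtype_apply, Set.mem_image, Finset.mem_coe,
      Finset.mem_filter, Finset.mem_univ, true_and] at ha ⊢
    obtain ⟨c, hc, rfl⟩ := ha
    exact ⟨⟨b, μ.isLowerSet hba c.2⟩, lt_of_le_of_lt (T.entry_mono hba) hc, rfl⟩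

/-! ### Jordan type of a nilpotent endomorphism -/

/-- `e`, indexed by the boxes of `μ`, is a Jordan basis of `u`: `u` kills the vectors of the first
column and sends every other vector to the one of the box just on the left. In particular `u` is
nilpotent and its Jordan blocks have the lengths of the rows of `μ` as sizes. -/
def IsJordanBasis {V : Type*} [AddCommGroup V] [Module ℂ V] (u : Module.End ℂ V)
    (e : Module.Basis μ.cells ℂ V) : Prop :=
  (∀ c : μ.cells, c.1.2 = 0 → u (e c) = 0) ∧
    ∀ c c' : μ.cells, c'.1.1 = c.1.1 → c'.1.2 + 1 = c.1.2 → u (e c) = e c'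

/-- `u` is nilpotent and its Jordan form is represented by the Young diagram `μ`, i.e.
`Y(u) = μ`. -/
def HasJordanType {V : Type*} [AddCommGroup V] [Module ℂ V] (u : Module.End ℂ V)
    (μ : YoungDiagram) : Prop :=
  ∃ e : Module.Basis μ.cells ℂ V, IsJordanBasis u e

/-! ### The variety of complete flags of `ℂⁿ` -/

/-- A complete flag `0 = V₀ ⊂ V₁ ⊂ … ⊂ Vₙ = ℂⁿ` with `dim Vᵢ = i`. -/
@[ext]
structure CompleteFlag (n : ℕ) where
  space : Fin (n + 1) → Submodule ℂ (Fin n → ℂ)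
  mono : Monotone space
  finrank_eq : ∀ i, Module.finrank ℂ (space i) = i

/-- The flag of the spans of the first vectors of a basis. -/
def CompleteFlag.ofBasis {n : ℕ} (b : Module.Basis (Fin n) ℂ (Fin n → ℂ)) : CompleteFlag n where
  space := b.flag
  mono := b.flag_mono
  finrank_eq i := by
    classical
    unfold Module.Basis.flag
    rw [finrank_span_set_eq_card
      (b.linearIndependent.linearIndepOn_id.mono (Set.image_subset_range _ _)),
      Set.toFinset_card, Set.card_image_of_injective _ b.injective, Fintype.card_subtype]
    have h : (Finset.univ.filter fun x : Fin n => x ∈ {j : Fin n | j.castSucc < i}) =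
        Finset.univ.filter fun x : Fin n => (x : ℕ) < i := by
      ext x
      simp [Fin.lt_def]
    rw [h, Fin.card_filter_val_lt]
    exact min_eq_right (Nat.lt_succ_iff.1 i.2)

/-- The Zariski topology on the affine space `ℂ^σ`. -/
abbrev zariskiTopology (σ : Type) : TopologicalSpace (σ → ℂ) :=
  TopologicalSpace.induced (MvPolynomial.pointToPoint (k := ℂ)) inferInstance

/-- The closed sets are the sets of common zeros of polynomials. -/
theorem isClosed_zariskiTopology_iff {σ : Type} (A : Set (σ → ℂ)) :
    IsClosed[zariskiTopology σ] A ↔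
      ∃ S : Set (MvPolynomial σ ℂ), A = {x | ∀ p ∈ S, MvPolynomial.eval x p = 0} := by
  have key : ∀ S : Set (MvPolynomial σ ℂ),
      MvPolynomial.pointToPoint (k := ℂ) ⁻¹' PrimeSpectrum.zeroLocus S =
        {x : σ → ℂ | ∀ p ∈ S, MvPolynomial.eval x p = 0} := by
    intro S
    ext x
    simp [MvPolynomial.pointToPoint, PrimeSpectrum.mem_zeroLocus, Set.subset_def,
      MvPolynomial.aeval_eq_eval]
  unfold zariskiTopology
  rw [isClosed_induced_iff]
  constructor
  · rintro ⟨t, ht, rfl⟩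
    obtain ⟨S, rfl⟩ := (PrimeSpectrum.isClosed_iff_zeroLocus t).1 ht
    exact ⟨S, key S⟩
  · rintro ⟨S, rfl⟩
    exact ⟨_, PrimeSpectrum.isClosed_zeroLocus S, key S⟩

/-- The bases of `ℂⁿ`, i.e. the group `GL(ℂⁿ)`, with the Zariski topology induced from the space
of `n × n` matrices (whose columns are the vectors of the basis). -/
abbrev basisTopology (n : ℕ) : TopologicalSpace (Module.Basis (Fin n) ℂ (Fin n → ℂ)) :=
  TopologicalSpace.induced (fun b (p : Fin n × Fin n) => b p.2 p.1)
    (zariskiTopology (Fin n × Fin n))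

/-- The Zariski topology on the variety of complete flags, as the quotient `GL(ℂⁿ) / B` of
`GL(ℂⁿ)` by a Borel subgroup: a set of flags is closed when the set of all bases adapted to its
members is Zariski closed in `GL(ℂⁿ)`. -/
instance (n : ℕ) : TopologicalSpace (CompleteFlag n) :=
  TopologicalSpace.coinduced CompleteFlag.ofBasis (basisTopology n)

/-! ### Springer fibers and their components -/

/-- The Springer fiber `𝓑_u`: the complete flags stable by `u`. -/
def springerFiber {n : ℕ} (u : Module.End ℂ (Fin n → ℂ)) : Set (CompleteFlag n) :=
  {F | ∀ i, ∀ x ∈ F.space i, u x ∈ F.space i}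

/-- The set `𝓑_u^T`: the flags of the Springer fiber such that, for all `i`, the Jordan form of
the restriction of `u` to `Vᵢ` is represented by the shape of the subtableau of the entries
`1, …, i` of `T`. -/
def spaltensteinSet {n : ℕ} (u : Module.End ℂ (Fin n → ℂ)) (T : StandardTableau μ) :
    Set (CompleteFlag n) :=
  {F | ∃ hF : F ∈ springerFiber u, ∀ i : Fin (n + 1),
    HasJordanType (u.restrict (hF i)) (T.shapeUpTo i)}

/-- The component `𝓚^T`: the Zariski closure of `𝓑_u^T` in the Springer fiber `𝓑_u`. -/
def component {n : ℕ} (u : Module.End ℂ (Fin n → ℂ)) (T : StandardTableau μ) :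
    Set (CompleteFlag n) :=
  springerFiber u ∩ closure (spaltensteinSet u T)

/-- The flag `F_τ` relative to a basis `e` indexed by the boxes of the shape of `τ`: its `i`-th
space is spanned by the vectors of the boxes of entries `1, …, i`. -/
def RowStandardTableau.toFlag (τ : RowStandardTableau μ)
    (e : Module.Basis μ.cells ℂ (Fin μ.card → ℂ)) : CompleteFlag μ.card :=
  CompleteFlag.ofBasis (e.reindex τ.entry)

/-- `τ ∈ T`, i.e. `(τ, T) ∈ 𝐊`: the flag `F_τ` lies in the component `𝓚^T` of the Springer fiber
`𝓑_u`, for any nilpotent `u` with `Y(u) = sh(T)` and any Jordan basis of `u`. -/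
def RowStandardTableau.InComponent (τ : RowStandardTableau μ) (T : StandardTableau μ) : Prop :=
  ∀ (u : Module.End ℂ (Fin μ.card → ℂ)) (e : Module.Basis μ.cells ℂ (Fin μ.card → ℂ)),
    IsJordanBasis u e → τ.toFlag e ∈ component u T

end Springer

end

/-! In a basis adapted to a flag of the Springer fiber, `u` has an upper triangular matrix whose
leading blocks represent the restrictions of `u` to the spaces `V_i`. So lying in `𝓑_u^T` is a
condition on this matrix: it belongs to `adaptedMatrices`. Since near `J` the matrices of the Jordan
type of `J` are conjugate to `J` by a polynomial family (`exists_conjugating_section`), closures can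
be carried between flags and matrices. Hence `τ ∈ T` means that the shift matrix `N` of `τ` is in
the Zariski closure of the adapted matrices (`inComponent_iff`).

By `τ' ⊆ τ`, the shift matrix of `τ'` is a leading block of `N`; by `T' ⊆ T`, the conditions for
`T'` are the first ones for `T`. Truncation to a leading block is polynomial, hence respects
closures: this is (a).

For (b), truncation is inverted near `N`, one entry at a time
(`shiftMatrix_succ_mem_zariskiClosure`). The column hypothesis forces each intermediate block `N_k`
to have the Jordan type prescribed by `T`, so an adapted `A` near `N_k` satisfies `A G(A) = G(A)
N_k` with `G` polynomial and `G(N_k) = 1`. If `v` is the column that borders `N_k` in `N_(k+1)`,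
bordering `A` by `G(A) v` gives a conjugate of `N_(k+1)`, which is therefore adapted and tends to
`N_(k+1)` in the sense of Zariski closure. -/

noncomputable section

namespace Springer

open Matrix

/-! ### Polynomial functions of a square matrix -/

/-- Polynomials in the entries of an `n × n` matrix. -/
abbrev MatrixPolynomial (n : ℕ) := MvPolynomial (Fin n × Fin n) ℂ

/-- Evaluation of a polynomial at a matrix. -/
def evalAt {n : ℕ} (A : Matrix (Fin n) (Fin n) ℂ) : MatrixPolynomial n →+* ℂ :=
  MvPolynomial.eval fun q => A q.1 q.2

@[simp]
theorem evalAt_C {n : ℕ} (A : Matrix (Fin n) (Fin n) ℂ) (a : ℂ) :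
    evalAt A (MvPolynomial.C a) = a := by
  simp [evalAt]

theorem map_evalAt_mvPolynomialX {n : ℕ} (A : Matrix (Fin n) (Fin n) ℂ) :
    (mvPolynomialX (Fin n) (Fin n) ℂ).map (evalAt A) = A := by
  ext i j
  simp [evalAt]

@[simp]
theorem map_evalAt_map_C {n : ℕ} {α β : Type*} (A : Matrix (Fin n) (Fin n) ℂ)
    (P : Matrix α β ℂ) : (P.map (MvPolynomial.C (σ := Fin n × Fin n))).map (evalAt A) = P := by
  ext i j
  simp

theorem map_evalAt_adjugate {n : ℕ} {ι : Type*} [Fintype ι] [DecidableEq ι]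
    (A : Matrix (Fin n) (Fin n) ℂ) (G : Matrix ι ι (MatrixPolynomial n)) :
    G.adjugate.map (evalAt A) = (G.map (evalAt A)).adjugate :=
  (evalAt A).map_adjugate G

theorem evalAt_det {n : ℕ} {ι : Type*} [Fintype ι] [DecidableEq ι]
    (A : Matrix (Fin n) (Fin n) ℂ) (G : Matrix ι ι (MatrixPolynomial n)) :
    evalAt A G.det = (G.map (evalAt A)).det :=
  (evalAt A).map_det G

/-- Substitution of a matrix of polynomials in a polynomial. -/
def substitute {m n : ℕ} (Φ : Matrix (Fin m) (Fin m) (MatrixPolynomial n)) :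
    MatrixPolynomial m →+* MatrixPolynomial n :=
  MvPolynomial.eval₂Hom MvPolynomial.C fun q => Φ q.1 q.2

theorem evalAt_substitute {m n : ℕ} (Φ : Matrix (Fin m) (Fin m) (MatrixPolynomial n))
    (A : Matrix (Fin n) (Fin n) ℂ) (p : MatrixPolynomial m) :
    evalAt A (substitute Φ p) = evalAt (Φ.map (evalAt A)) p := by
  suffices h : (evalAt A).comp (substitute Φ) = evalAt (Φ.map (evalAt A)) from
    DFunLike.congr_fun h p
  refine MvPolynomial.ringHom_ext (fun a => ?_) fun q => ?_ <;> simp [substitute, evalAt]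

/-- The Zariski closure of a set of matrices. -/
def zariskiClosure {n : ℕ} (S : Set (Matrix (Fin n) (Fin n) ℂ)) :
    Set (Matrix (Fin n) (Fin n) ℂ) :=
  {A | ∀ p : MatrixPolynomial n, (∀ M ∈ S, evalAt M p = 0) → evalAt A p = 0}

/-- A polynomial map which sends the points of `S` outside a hypersurface to `S'` sends the
points of the closure of `S` outside this hypersurface to the closure of `S'`. -/
theorem map_mem_zariskiClosure {m n : ℕ} {S : Set (Matrix (Fin n) (Fin n) ℂ)}
    {S' : Set (Matrix (Fin m) (Fin m) ℂ)} (Φ : Matrix (Fin m) (Fin m) (MatrixPolynomial n))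
    (q : MatrixPolynomial n) (h : ∀ M ∈ S, evalAt M q ≠ 0 → Φ.map (evalAt M) ∈ S')
    {A : Matrix (Fin n) (Fin n) ℂ} (hA : A ∈ zariskiClosure S) (hq : evalAt A q ≠ 0) :
    Φ.map (evalAt A) ∈ zariskiClosure S' := by
  intro p hp
  -- The factor `q` makes the polynomial vanish also at the points of `S` where nothing is known
  -- about `Φ`.
  have := hA (q * substitute Φ p) fun M hM => by
    by_cases h0 : evalAt M q = 0
    · simp [h0]
    · rw [map_mul, evalAt_substitute, hp _ (h M hM h0), mul_zero]
  rw [map_mul, evalAt_substitute] at this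
  exact (mul_eq_zero.1 this).resolve_left hq

/-! ### Polynomial sections -/

/-- The columns of `Q` are preimages of a basis of the range, and `P` is a left inverse of the
inclusion of the range. With `P` and `Q` fixed, invertibility of `P * M * Q` is an open condition on
`M`. -/
theorem exists_mul_mul_eq_one {n : ℕ} (M : Matrix (Fin n) (Fin n) ℂ) :
    ∃ (P : Matrix (Fin M.rank) (Fin n) ℂ) (Q : Matrix (Fin n) (Fin M.rank) ℂ),
      P * M * Q = 1 := by
  have b : Module.Basis (Fin M.rank) ℂ (LinearMap.range M.mulVecLin) :=
    Module.finBasisOfFinrankEq _ _ rfl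
  choose q hq using fun i => (b i).2
  obtain ⟨P, hP⟩ := LinearMap.exists_leftInverse_of_injective
    ((LinearMap.range M.mulVecLin).subtype ∘ₗ b.equivFun.symm.toLinearMap) (by
      rw [LinearMap.ker_eq_bot]
      exact (Submodule.subtype_injective _).comp b.equivFun.symm.injective)
  refine ⟨LinearMap.toMatrix' P, (Matrix.of q)ᵀ, ?_⟩
  ext i j
  have h1 : P (b j) = Pi.single j 1 := by
    simpa using DFunLike.congr_fun hP (Pi.single j 1)
  have h2 : (LinearMap.toMatrix' P * M * (Matrix.of q)ᵀ) i j =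
      (LinearMap.toMatrix' P *ᵥ (M *ᵥ q j)) i := by
    rw [mulVec_mulVec]
    rfl
  have h3 : M *ᵥ q j = b j := hq j
  rw [h2, h3, LinearMap.toMatrix'_mulVec, h1]
  simp [Matrix.one_apply, Pi.single_apply]

/-- If `P * M * Q` is invertible of size at least the rank of `M`, then `P` is injective on the
range of `M`. -/
theorem mulVec_eq_zero_of_det_ne_zero {n r : ℕ} {M : Matrix (Fin n) (Fin n) ℂ}
    {P : Matrix (Fin r) (Fin n) ℂ} {Q : Matrix (Fin n) (Fin r) ℂ} (hr : M.rank ≤ r)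
    (h : (P * M * Q).det ≠ 0) {v : Fin n → ℂ} (hv : P *ᵥ (M *ᵥ v) = 0) : M *ᵥ v = 0 := by
  have h1 : r ≤ (P * M).rank := by
    have h2 : (P * M * Q).rank = r := by
      simpa using Matrix.rank_of_isUnit _ ((Matrix.isUnit_iff_isUnit_det _).2 h.isUnit)
    exact h2.symm.le.trans (Matrix.rank_mul_le_left _ _)
  -- One kernel contains the other, and the ranks compare in the opposite direction.
  have h3 : LinearMap.ker M.mulVecLin = LinearMap.ker (P * M).mulVecLin := by
    refine Submodule.eq_of_le_of_finrank_le (fun x hx => ?_) ?_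
    · have hx' : M *ᵥ x = 0 := hx
      change (P * M) *ᵥ x = 0
      rw [← mulVec_mulVec, hx', mulVec_zero]
    · have h4 := M.mulVecLin.finrank_range_add_finrank_ker
      have h5 := (P * M).mulVecLin.finrank_range_add_finrank_ker
      have h6 : M.rank = Module.finrank ℂ (LinearMap.range M.mulVecLin) := rfl
      have h7 : (P * M).rank = Module.finrank ℂ (LinearMap.range (P * M).mulVecLin) := rfl
      omega
  have h8 : v ∈ LinearMap.ker (P * M).mulVecLin := by
    change (P * M) *ᵥ v = 0
    rw [← mulVec_mulVec, hv]
  rw [← h3] at h8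
  exact h8

/-- A vector of the kernel of a matrix extends to a polynomial family of vectors of the kernels
of the matrices of the same or smaller rank. -/
theorem exists_kernel_section {n : ℕ} {M₀ : Matrix (Fin n) (Fin n) ℂ} {v₀ : Fin n → ℂ}
    (h₀ : M₀ *ᵥ v₀ = 0) :
    ∃ v : Fin n → MatrixPolynomial n, evalAt M₀ ∘ v = v₀ ∧
      ∀ M : Matrix (Fin n) (Fin n) ℂ, M.rank ≤ M₀.rank → M *ᵥ (evalAt M ∘ v) = 0 := by
  obtain ⟨P, Q, hPQ⟩ := exists_mul_mul_eq_one M₀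
  let Y : Matrix (Fin M₀.rank) (Fin n) (MatrixPolynomial n) :=
    P.map (MvPolynomial.C (σ := Fin n × Fin n)) * mvPolynomialX (Fin n) (Fin n) ℂ
  let Z : Matrix (Fin n) (Fin M₀.rank) (MatrixPolynomial n) :=
    Q.map (MvPolynomial.C (σ := Fin n × Fin n))
  let K : Matrix (Fin M₀.rank) (Fin M₀.rank) (MatrixPolynomial n) := Y * Z
  let v₁ : Fin n → MatrixPolynomial n := MvPolynomial.C ∘ v₀
  have hv₁ : ∀ M : Matrix (Fin n) (Fin n) ℂ, evalAt M ∘ v₁ = v₀ := fun M => by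
    ext i
    simp [v₁]
  have hY : ∀ M : Matrix (Fin n) (Fin n) ℂ, Y.map (evalAt M) = P * M := fun M => by
    rw [show Y.map (evalAt M) = _ from Matrix.map_mul, map_evalAt_mvPolynomialX, map_evalAt_map_C]
  have hZ : ∀ M : Matrix (Fin n) (Fin n) ℂ, Z.map (evalAt M) = Q := fun M =>
    map_evalAt_map_C M Q
  have hK : ∀ M : Matrix (Fin n) (Fin n) ℂ, K.map (evalAt M) = P * M * Q := fun M => by
    rw [show K.map (evalAt M) = _ from Matrix.map_mul, hY, hZ]
  -- With `K = PMQ`, the vector `v₀ - Q K⁻¹ P M v₀` is killed by `P M`. One factor `K.det` clears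
  -- the denominator; the other makes the family vanish where `K` is singular.
  let w := K.det • (K.det • v₁ - Z *ᵥ (K.adjugate *ᵥ (Y *ᵥ v₁)))
  have hw : ∀ M : Matrix (Fin n) (Fin n) ℂ, evalAt M ∘ w = (P * M * Q).det •
      ((P * M * Q).det • v₀ - Q *ᵥ ((P * M * Q).adjugate *ᵥ ((P * M) *ᵥ v₀))) := fun M => by
    ext i
    have h1 : evalAt M ((Z *ᵥ (K.adjugate *ᵥ (Y *ᵥ v₁))) i) =
        (Q *ᵥ ((P * M * Q).adjugate *ᵥ ((P * M) *ᵥ v₀))) i := by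
      rw [mulVec_mulVec, mulVec_mulVec, mulVec_mulVec, mulVec_mulVec, RingHom.map_mulVec,
        Matrix.map_mul, Matrix.map_mul, hY, hZ, map_evalAt_adjugate, hK, hv₁]
    have h2 : evalAt M (v₁ i) = v₀ i := congrFun (hv₁ M) i
    simp only [w, Function.comp_apply, Pi.smul_apply, Pi.sub_apply, smul_eq_mul, map_mul, map_sub,
      h1, h2, evalAt_det, hK]
  refine ⟨w, ?_, fun M hM => ?_⟩
  · rw [hw, hPQ, ← mulVec_mulVec, h₀]
    simp
  · rw [hw]
    by_cases hd : (P * M * Q).det = 0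
    · simp [hd]
    · refine mulVec_eq_zero_of_det_ne_zero hM hd ?_
      have h1 : (P * M) *ᵥ (Q *ᵥ ((P * M * Q).adjugate *ᵥ ((P * M) *ᵥ v₀))) =
          (P * M * Q).det • ((P * M) *ᵥ v₀) := by
        rw [mulVec_mulVec, mulVec_mulVec, mul_adjugate, smul_mulVec, one_mulVec]
      rw [mulVec_mulVec, mulVec_smul, mulVec_sub, mulVec_smul, h1, sub_self, smul_zero]

/-! ### Jordan bases -/

variable {μ μ' : YoungDiagram}

theorem IsJordanBasis.map {V W : Type*} [AddCommGroup V] [Module ℂ V] [AddCommGroup W]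
    [Module ℂ W] {u : Module.End ℂ V} {e : Module.Basis μ.cells ℂ V} (h : IsJordanBasis u e)
    {w : Module.End ℂ W} (φ : V ≃ₗ[ℂ] W) (hφ : ∀ x, w (φ x) = φ (u x)) :
    IsJordanBasis w (e.map φ) := by
  refine ⟨fun c hc => ?_, fun c c' h1 h2 => ?_⟩
  · rw [Module.Basis.map_apply, hφ, h.1 c hc, map_zero]
  · rw [Module.Basis.map_apply, hφ, h.2 c c' h1 h2, Module.Basis.map_apply]

theorem HasJordanType.map {V W : Type*} [AddCommGroup V] [Module ℂ V] [AddCommGroup W]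
    [Module ℂ W] {u : Module.End ℂ V} (h : HasJordanType u μ)
    {w : Module.End ℂ W} (φ : V ≃ₗ[ℂ] W) (hφ : ∀ x, w (φ x) = φ (u x)) :
    HasJordanType w μ := by
  obtain ⟨e, he⟩ := h
  exact ⟨_, he.map φ hφ⟩

theorem IsJordanBasis.apply_equiv {V W : Type*} [AddCommGroup V] [Module ℂ V] [AddCommGroup W]
    [Module ℂ W] {u : Module.End ℂ V} {w : Module.End ℂ W} {e : Module.Basis μ.cells ℂ V}
    {f : Module.Basis μ.cells ℂ W} (he : IsJordanBasis u e) (hf : IsJordanBasis w f) (x : V) :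
    w (e.equiv f (Equiv.refl _) x) = e.equiv f (Equiv.refl _) (u x) := by
  suffices h : w ∘ₗ (e.equiv f (Equiv.refl _)).toLinearMap =
      (e.equiv f (Equiv.refl _)).toLinearMap ∘ₗ u from DFunLike.congr_fun h x
  refine e.ext fun c => ?_
  simp only [LinearMap.comp_apply, LinearEquiv.coe_coe, Module.Basis.equiv_apply,
    Equiv.refl_apply]
  rcases Nat.eq_zero_or_pos c.1.2 with h0 | h0
  · rw [he.1 c h0, hf.1 c h0, map_zero]
  · have hc : (c.1.1, c.1.2 - 1) ∈ μ.cells :=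
      μ.isLowerSet (show (c.1.1, c.1.2 - 1) ≤ c.1 from ⟨le_rfl, Nat.sub_le _ _⟩) c.2
    rw [he.2 c ⟨_, hc⟩ rfl (Nat.sub_add_cancel h0), hf.2 c ⟨_, hc⟩ rfl (Nat.sub_add_cancel h0),
      Module.Basis.equiv_apply, Equiv.refl_apply]

/-- Matching Jordan bases box by box conjugates one matrix to the other. The constancy of these
ranks is what allows `exists_kernel_section` to be applied to powers. -/
theorem rank_pow_eq_of_hasJordanType {n : ℕ} {A B : Matrix (Fin n) (Fin n) ℂ}
    (hA : HasJordanType (toLin' A) μ) (hB : HasJordanType (toLin' B) μ) (j : ℕ) :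
    (A ^ j).rank = (B ^ j).rank := by
  obtain ⟨e, he⟩ := hA
  obtain ⟨f, hf⟩ := hB
  let φ := e.equiv f (Equiv.refl _)
  let P := LinearMap.toMatrix' φ.toLinearMap
  let Q := LinearMap.toMatrix' φ.symm.toLinearMap
  have hQP : Q * P = 1 := by
    rw [← LinearMap.toMatrix'_comp]
    simp
  have hPQ : P * Q = 1 := mul_eq_one_comm.1 hQP
  have h1 : B * P = P * A := by
    apply toLin'.injective
    refine LinearMap.ext fun x => ?_
    simpa [P, toLin'_mul] using he.apply_equiv hf x
  have h2 : SemiconjBy P (A ^ j) (B ^ j) := SemiconjBy.pow_right (show P * A = B * P from h1.symm) j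
  have h3 : P * A ^ j = B ^ j * P := h2
  have hP : IsUnit P.det := Matrix.isUnit_det_of_left_inverse hQP
  rw [← Matrix.rank_mul_eq_right_of_isUnit_det P (A ^ j) hP, h3,
    Matrix.rank_mul_eq_left_of_isUnit_det P (B ^ j) hP]

theorem IsJordanBasis.pow_mulVec {n : ℕ} {A : Matrix (Fin n) (Fin n) ℂ}
    {e : Module.Basis μ.cells ℂ (Fin n → ℂ)} (he : IsJordanBasis (toLin' A) e) {j : ℕ} :
    ∀ {c d : μ.cells}, c.1.1 = d.1.1 → c.1.2 + j = d.1.2 → (A ^ j) *ᵥ e d = e c := by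
  induction j with
  | zero =>
    intro c d h1 h2
    have : c = d := Subtype.ext (Prod.ext h1 h2)
    simp [this]
  | succ j ih =>
    intro c d h1 h2
    have hd : (d.1.1, d.1.2 - 1) ∈ μ.cells :=
      μ.isLowerSet (show (d.1.1, d.1.2 - 1) ≤ d.1 from ⟨le_rfl, Nat.sub_le _ _⟩) d.2
    have h3 : A *ᵥ e d = e ⟨_, hd⟩ := he.2 d ⟨_, hd⟩ rfl (show d.1.2 - 1 + 1 = d.1.2 by omega)
    rw [pow_succ, ← mulVec_mulVec, h3]
    exact ih h1 (show c.1.2 + j = d.1.2 - 1 by omega)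

theorem IsJordanBasis.pow_rowLen_mulVec {n : ℕ} {A : Matrix (Fin n) (Fin n) ℂ}
    {e : Module.Basis μ.cells ℂ (Fin n → ℂ)} (he : IsJordanBasis (toLin' A) e) (d : μ.cells) :
    (A ^ μ.rowLen d.1.1) *ᵥ e d = 0 := by
  have hd : (d.1.1, 0) ∈ μ.cells :=
    μ.isLowerSet (show (d.1.1, 0) ≤ d.1 from ⟨le_rfl, Nat.zero_le _⟩) d.2
  have h1 : (A ^ d.1.2) *ᵥ e d = e ⟨_, hd⟩ := he.pow_mulVec rfl (Nat.zero_add _)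
  have h2 : A *ᵥ e ⟨_, hd⟩ = 0 := he.1 ⟨_, hd⟩ rfl
  have h3 : d.1.2 < μ.rowLen d.1.1 := YoungDiagram.mem_iff_lt_rowLen.1 d.2
  obtain ⟨k, hk⟩ := Nat.exists_eq_add_of_lt h3
  rw [hk, show d.1.2 + k + 1 = k + 1 + d.1.2 by omega, pow_add, ← mulVec_mulVec, h1, pow_succ,
    ← mulVec_mulVec, h2, mulVec_zero]

/-- The vectors of a Jordan basis extend to polynomial families of vectors which satisfy the
relations of a Jordan basis for all matrices of the same Jordan type. -/
theorem IsJordanBasis.exists_section {n : ℕ} {J : Matrix (Fin n) (Fin n) ℂ}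
    {e : Module.Basis μ.cells ℂ (Fin n → ℂ)} (he : IsJordanBasis (toLin' J) e) :
    ∃ g : μ.cells → Fin n → MatrixPolynomial n, (∀ c, evalAt J ∘ g c = e c) ∧
      ∀ A, HasJordanType (toLin' A) μ →
        (∀ c : μ.cells, c.1.2 = 0 → A *ᵥ (evalAt A ∘ g c) = 0) ∧
        ∀ c c' : μ.cells, c'.1.1 = c.1.1 → c'.1.2 + 1 = c.1.2 →
          A *ᵥ (evalAt A ∘ g c) = evalAt A ∘ g c' := by
  -- The vector of the last box generates its whole row, and its only relation is to be killed by
  -- the power `μ.rowLen i`. It is thus enough to extend it as a kernel vector of this power.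
  -- Indices without boxes get the family `0`.
  have hrow : ∀ i : ℕ, ∃ w : Fin n → MatrixPolynomial n,
      (∀ d : μ.cells, d.1.1 = i → d.1.2 + 1 = μ.rowLen i → evalAt J ∘ w = e d) ∧
      ∀ A, HasJordanType (toLin' A) μ → (A ^ μ.rowLen i) *ᵥ (evalAt A ∘ w) = 0 := by
    intro i
    by_cases hd : ∃ d : μ.cells, d.1.1 = i ∧ d.1.2 + 1 = μ.rowLen i
    · obtain ⟨d, rfl, hd⟩ := hd
      obtain ⟨v, hv, hv'⟩ := exists_kernel_section (he.pow_rowLen_mulVec d)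
      let Y : Matrix (Fin n) (Fin n) (MatrixPolynomial n) :=
        mvPolynomialX (Fin n) (Fin n) ℂ ^ μ.rowLen d.1.1
      have hY : ∀ A, Y.map (evalAt A) = A ^ μ.rowLen d.1.1 := fun A => by
        have := map_pow (evalAt A).mapMatrix (mvPolynomialX (Fin n) (Fin n) ℂ) (μ.rowLen d.1.1)
        rwa [RingHom.mapMatrix_apply, RingHom.mapMatrix_apply, map_evalAt_mvPolynomialX] at this
      have hw : ∀ A, (evalAt A ∘ fun k => substitute Y (v k)) =
          evalAt (A ^ μ.rowLen d.1.1) ∘ v := fun A => by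
        ext k
        rw [Function.comp_apply, evalAt_substitute, hY, Function.comp_apply]
      refine ⟨fun k => substitute Y (v k), fun d' h1 h2 => ?_, fun A hA => ?_⟩
      · have : d' = d := Subtype.ext (Prod.ext h1 (by omega))
        rw [hw, hv, this]
      · rw [hw]
        exact hv' _ (rank_pow_eq_of_hasJordanType hA ⟨e, he⟩ _).le
    · refine ⟨0, fun d h1 h2 => (hd ⟨d, h1, h2⟩).elim, fun A _ => ?_⟩
      have : evalAt A ∘ (0 : Fin n → MatrixPolynomial n) = 0 := by
        ext
        simp
      rw [this, mulVec_zero]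
  choose w hw hw' using hrow
  have hX : ∀ A (k : ℕ) (v : Fin n → MatrixPolynomial n),
      evalAt A ∘ ((mvPolynomialX (Fin n) (Fin n) ℂ ^ k) *ᵥ v) = (A ^ k) *ᵥ (evalAt A ∘ v) := by
    intro A k v
    ext i
    have := map_pow (evalAt A).mapMatrix (mvPolynomialX (Fin n) (Fin n) ℂ) k
    rw [RingHom.mapMatrix_apply, RingHom.mapMatrix_apply, map_evalAt_mvPolynomialX] at this
    rw [Function.comp_apply, RingHom.map_mulVec, this]
  have hlt : ∀ c : μ.cells, c.1.2 < μ.rowLen c.1.1 := fun c =>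
    YoungDiagram.mem_iff_lt_rowLen.1 c.2
  refine ⟨fun c => (mvPolynomialX (Fin n) (Fin n) ℂ ^ (μ.rowLen c.1.1 - 1 - c.1.2)) *ᵥ w c.1.1,
    fun c => ?_, fun A hA => ⟨fun c hc => ?_, fun c c' h1 h2 => ?_⟩⟩
  · have hc := hlt c
    have hd : (c.1.1, μ.rowLen c.1.1 - 1) ∈ μ.cells :=
      YoungDiagram.mem_iff_lt_rowLen.2 (by omega)
    rw [hX, hw c.1.1 ⟨_, hd⟩ rfl (show μ.rowLen c.1.1 - 1 + 1 = μ.rowLen c.1.1 by omega)]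
    exact he.pow_mulVec rfl
      (show c.1.2 + (μ.rowLen c.1.1 - 1 - c.1.2) = μ.rowLen c.1.1 - 1 by omega)
  · have := hlt c
    rw [hX, mulVec_mulVec, ← pow_succ',
      show μ.rowLen c.1.1 - 1 - c.1.2 + 1 = μ.rowLen c.1.1 by omega]
    exact hw' _ A hA
  · have := hlt c
    rw [hX, hX, mulVec_mulVec, ← pow_succ', h1,
      show μ.rowLen c.1.1 - 1 - c.1.2 + 1 = μ.rowLen c.1.1 - 1 - c'.1.2 by omega]

/-- The matrices of the Jordan type of `J` are conjugate to `J` by a polynomial family of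
matrices, wherever this family is invertible. -/
theorem exists_conjugating_section {n : ℕ} {J : Matrix (Fin n) (Fin n) ℂ}
    (hJ : HasJordanType (toLin' J) μ) :
    ∃ G : Matrix (Fin n) (Fin n) (MatrixPolynomial n), G.map (evalAt J) = 1 ∧
      ∀ A, HasJordanType (toLin' A) μ → A * G.map (evalAt A) = G.map (evalAt A) * J := by
  obtain ⟨e, he⟩ := hJ
  obtain ⟨g, hg, hg'⟩ := he.exists_section
  -- `G(A)` is the linear map sending the Jordan basis vector `e c` of `J` to the value of `g c` at
  -- `A`.
  let G : Matrix (Fin n) (Fin n) (MatrixPolynomial n) := Matrix.of fun i j =>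
    ∑ c, MvPolynomial.C (e.repr (Pi.single j 1) c) * g c i
  have hG : ∀ A x, (G.map (evalAt A)) *ᵥ x = ∑ c, e.repr x c • (evalAt A ∘ g c) := by
    intro A
    suffices h : toLin' (G.map (evalAt A)) =
        (e.constr ℂ fun c => evalAt A ∘ g c) from fun x => by
      have := DFunLike.congr_fun h x
      rwa [toLin'_apply, Module.Basis.constr_apply_fintype] at this
    refine (Pi.basisFun ℂ (Fin n)).ext fun j => ?_
    rw [Module.Basis.constr_apply_fintype]
    ext i
    simp [G, map_sum, Finset.sum_apply]
  have hGe : ∀ A c, (G.map (evalAt A)) *ᵥ e c = evalAt A ∘ g c := by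
    intro A c
    rw [hG, Finset.sum_eq_single c]
    · simp
    · intro d _ hd
      simp [hd.symm]
    · simp
  refine ⟨G, ?_, fun A hA => ?_⟩
  · apply toLin'.injective
    refine e.ext fun c => ?_
    rw [toLin'_apply, hGe, hg, toLin'_one, LinearMap.id_apply]
  · apply toLin'.injective
    refine e.ext fun c => ?_
    rw [toLin'_apply, toLin'_apply, ← mulVec_mulVec, ← mulVec_mulVec, hGe]
    rcases Nat.eq_zero_or_pos c.1.2 with h0 | h0
    · have h1 : J *ᵥ e c = 0 := he.1 c h0
      rw [h1, mulVec_zero, (hg' A hA).1 c h0]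
    · have hc : (c.1.1, c.1.2 - 1) ∈ μ.cells :=
        μ.isLowerSet (show (c.1.1, c.1.2 - 1) ≤ c.1 from ⟨le_rfl, Nat.sub_le _ _⟩) c.2
      have h1 : J *ᵥ e c = e ⟨_, hc⟩ := he.2 c ⟨_, hc⟩ rfl (Nat.sub_add_cancel h0)
      rw [h1, hGe, (hg' A hA).2 c ⟨_, hc⟩ rfl (Nat.sub_add_cancel h0)]

/-! ### Shift matrices -/

theorem mem_iff_lt_card_of_isLowerSet {S : Finset ℕ} (h : ∀ c, c + 1 ∈ S → c ∈ S) (c : ℕ) :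
    c ∈ S ↔ c < S.card := by
  have hlow : ∀ c ∈ S, ∀ d ≤ c, d ∈ S := by
    intro c hc d hd
    induction hd using Nat.decreasingInduction with
    | self => exact hc
    | of_succ k _ ih => exact h k ih
  have hsub : S ⊆ Finset.range S.card := by
    intro c hc
    have : Finset.range (c + 1) ⊆ S := fun d hd =>
      hlow c hc d (Nat.lt_succ_iff.1 (Finset.mem_range.1 hd))
    have := Finset.card_le_card this
    rw [Finset.card_range] at this
    exact Finset.mem_range.2 this
  have heq := Finset.eq_of_subset_of_card_le hsub (by simp)
  rw [← Finset.mem_range, ← heq]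

/-- The matrix of the endomorphism sending each vector of the standard basis, indexed by boxes in
given rows and columns, to the vector of the box on the left. -/
def leftShift {k : ℕ} (row col : Fin k → ℕ) : Matrix (Fin k) (Fin k) ℂ :=
  Matrix.of fun i j => if row i = row j ∧ col i + 1 = col j then 1 else 0

theorem card_filter_col_eq_colLen (ν : YoungDiagram) (c : ℕ) :
    (ν.cells.filter fun x => x.2 = c).card = ν.colLen c := by
  rw [YoungDiagram.colLen_eq_card]
  rfl

/-- A finite set of left-justified rows of boxes with the same number of boxes in each column as
a Young diagram is obtained from this diagram by permuting the rows. -/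
theorem exists_equiv_cells {k : ℕ} {row col : Fin k → ℕ}
    (hinj : ∀ i j, row i = row j → col i = col j → i = j)
    (hleft : ∀ i, col i ≠ 0 → ∃ j, row j = row i ∧ col j + 1 = col i) {ν : YoungDiagram}
    (hcount : ∀ c, (Finset.univ.filter fun i => col i = c).card =
      (ν.cells.filter fun x => x.2 = c).card) :
    ∃ ψ : Fin k ≃ ν.cells, (∀ i, (ψ i).1.2 = col i) ∧
      ∀ i j, (ψ i).1.1 = (ψ j).1.1 → row i = row j := by
  classical
  let cols : ℕ → Finset ℕ := fun r => (Finset.univ.filter fun i => row i = r).image col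
  have hmem : ∀ r c, c ∈ cols r ↔ ∃ i, row i = r ∧ col i = c := fun r c => by simp [cols]
  have hcols : ∀ r c, c ∈ cols r ↔ c < (cols r).card := fun r =>
    mem_iff_lt_card_of_isLowerSet fun c hc => by
      obtain ⟨i, hi, hi'⟩ := (hmem _ _).1 hc
      obtain ⟨j, hj, hj'⟩ := hleft i (by omega)
      exact (hmem _ _).2 ⟨j, hj.trans hi, by omega⟩
  let rows : Finset ℕ := Finset.univ.image row
  -- The rows are sorted by decreasing length, ties being broken by index; the number of preceding
  -- rows is the new row index.
  let before : ℕ → Finset ℕ := fun r => rows.filter fun r' =>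
    (cols r).card < (cols r').card ∨ ((cols r').card = (cols r).card ∧ r' < r)
  have hbefore : ∀ r r', r' ∈ before r ↔ r' ∈ rows ∧
      ((cols r).card < (cols r').card ∨ ((cols r').card = (cols r).card ∧ r' < r)) :=
    fun r r' => Finset.mem_filter
  have hlt : ∀ r r', r' ∈ before r → (before r').card < (before r).card := by
    intro r r' h
    refine Finset.card_lt_card ((Finset.ssubset_iff_of_subset fun s hs => ?_).2 ⟨r', h, ?_⟩)
    · rw [hbefore] at h hs ⊢
      exact ⟨hs.1, by omega⟩
    · rw [hbefore]
      omega
  have hrank : ∀ i j, (before (row i)).card = (before (row j)).card → row i = row j := by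
    intro i j h
    by_contra hne
    have hi : row i ∈ rows := Finset.mem_image_of_mem _ (Finset.mem_univ _)
    have hj : row j ∈ rows := Finset.mem_image_of_mem _ (Finset.mem_univ _)
    have : row i ∈ before (row j) ∨ row j ∈ before (row i) := by
      rw [hbefore, hbefore]
      simp only [hi, hj, true_and]
      omega
    rcases this with h' | h'
    · exact (hlt _ _ h').ne h
    · exact (hlt _ _ h').ne h.symm
  -- All rows before that of `i` are at least as long, so they meet column `col i`. So does the row
  -- of `i`, which does not precede itself: hence the strict inequality with the column length.
  have hν : ∀ i, ((before (row i)).card, col i) ∈ ν.cells := by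
    intro i
    rw [YoungDiagram.mem_cells, YoungDiagram.mem_iff_lt_colLen, ← card_filter_col_eq_colLen,
      ← hcount, ← Finset.card_image_of_injOn (f := row) (s := Finset.univ.filter _)]
    · refine Finset.card_lt_card ((Finset.ssubset_iff_of_subset fun r hr => ?_).2
        ⟨row i, ?_, ?_⟩)
      · rw [hbefore] at hr
        have h1 : col i ∈ cols (row i) := (hmem _ _).2 ⟨i, rfl, rfl⟩
        have h2 : col i ∈ cols r := by
          rw [hcols] at h1 ⊢
          omega
        obtain ⟨j, hj, hj'⟩ := (hmem _ _).1 h2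
        exact Finset.mem_image.2 ⟨j, by simpa using hj', hj⟩
      · exact Finset.mem_image.2 ⟨i, by simp, rfl⟩
      · rw [hbefore]
        omega
    · intro a ha b hb hab
      simp only [Finset.coe_filter, Finset.mem_univ, true_and, Set.mem_ofPred_eq] at ha hb
      exact hinj a b hab (ha.trans hb.symm)
  let f : Fin k → ν.cells := fun i => ⟨_, hν i⟩
  have hf : Function.Injective f := by
    intro i j h
    have h' := congrArg Subtype.val h
    exact hinj i j (hrank i j (congrArg Prod.fst h')) (congrArg Prod.snd h')
  have hcard : Fintype.card (Fin k) = Fintype.card ν.cells := by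
    let t : Finset ℕ := Finset.univ.image col ∪ ν.cells.image Prod.snd
    have h1 := Finset.card_eq_sum_card_fiberwise (f := col) (s := Finset.univ) (t := t)
      fun i _ => Finset.mem_coe.2 (Finset.mem_union_left _
        (Finset.mem_image_of_mem _ (Finset.mem_univ i)))
    have h2 := Finset.card_eq_sum_card_fiberwise (f := Prod.snd) (s := ν.cells) (t := t)
      fun x hx => Finset.mem_coe.2 (Finset.mem_union_right _ (Finset.mem_image_of_mem _ hx))
    rw [Fintype.card_coe, h2, ← Finset.card_univ, h1]
    exact Finset.sum_congr rfl fun c _ => hcount c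
  refine ⟨Equiv.ofBijective f ((Fintype.bijective_iff_injective_and_card f).2 ⟨hf, hcard⟩),
    fun i => rfl, fun i j h => hrank i j h⟩

theorem hasJordanType_leftShift {k : ℕ} {row col : Fin k → ℕ}
    (hinj : ∀ i j, row i = row j → col i = col j → i = j)
    (hleft : ∀ i, col i ≠ 0 → ∃ j, row j = row i ∧ col j + 1 = col i) {ν : YoungDiagram}
    (hcount : ∀ c, (Finset.univ.filter fun i => col i = c).card =
      (ν.cells.filter fun x => x.2 = c).card) :
    HasJordanType (toLin' (leftShift row col)) ν := by
  obtain ⟨ψ, hψ, hψ'⟩ := exists_equiv_cells hinj hleft hcount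
  refine ⟨(Pi.basisFun ℂ (Fin k)).reindex ψ, fun c hc => ?_, fun c c' h1 h2 => ?_⟩
  · have h0 : col (ψ.symm c) = 0 := by rw [← hψ, ψ.apply_symm_apply, hc]
    ext i
    simp [leftShift, h0]
  · have h3 : row (ψ.symm c') = row (ψ.symm c) := hψ' _ _ (by simpa using h1)
    have h4 : col (ψ.symm c') + 1 = col (ψ.symm c) := by
      rw [← hψ, ← hψ, ψ.apply_symm_apply, ψ.apply_symm_apply, h2]
    ext i
    have h5 : (row i = row (ψ.symm c) ∧ col i + 1 = col (ψ.symm c)) ↔ i = ψ.symm c' :=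
      ⟨fun h => hinj _ _ (h.1.trans h3.symm) (by omega), fun h => by rw [h]; exact ⟨h3, h4⟩⟩
    simp [leftShift, h5, Pi.single_apply]

/-! ### Tableaux and their shift matrices -/

namespace RowStandardTableau

variable (τ : RowStandardTableau μ)

theorem entry_lt_iff {c d : μ.cells} (h : c.1.1 = d.1.1) :
    τ.entry c < τ.entry d ↔ c.1.2 < d.1.2 := by
  refine ⟨fun hlt => ?_, τ.row_strict c d h⟩
  by_contra hle
  rcases (not_lt.1 hle).eq_or_lt with he | hl
  · have : c = d := Subtype.ext (Prod.ext h he.symm)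
    exact hlt.ne (congrArg _ this)
  · exact (τ.row_strict d c h.symm hl).not_gt hlt

theorem lt_iff_colOf_lt {i j : Fin μ.card} (h : τ.rowOf i = τ.rowOf j) :
    i < j ↔ τ.colOf i < τ.colOf j := by
  have := τ.entry_lt_iff (c := τ.entry.symm i) (d := τ.entry.symm j) h
  rwa [τ.entry.apply_symm_apply, τ.entry.apply_symm_apply] at this

theorem eq_of_rowOf_eq {i j : Fin μ.card} (h : τ.rowOf i = τ.rowOf j)
    (h' : τ.colOf i = τ.colOf j) : i = j :=
  τ.entry.symm.injective (Subtype.ext (Prod.ext h h'))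

theorem exists_rowOf_colOf (i : Fin μ.card) {c : ℕ} (hc : c < τ.colOf i) :
    ∃ j < i, τ.rowOf j = τ.rowOf i ∧ τ.colOf j = c := by
  have hmem : (τ.rowOf i, c) ∈ μ.cells :=
    μ.isLowerSet (show (τ.rowOf i, c) ≤ (τ.entry.symm i).1 from ⟨le_rfl, hc.le⟩)
      (τ.entry.symm i).2
  have h1 : τ.rowOf (τ.entry ⟨_, hmem⟩) = τ.rowOf i := by simp [rowOf]
  have h2 : τ.colOf (τ.entry ⟨_, hmem⟩) = c := by simp [colOf]
  exact ⟨τ.entry ⟨_, hmem⟩, (τ.lt_iff_colOf_lt h1).2 (by omega), h1, h2⟩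

/-- The shift matrix of the subtableau of the first `k` entries. -/
def shiftMatrix {k : ℕ} (hk : k ≤ μ.card) : Matrix (Fin k) (Fin k) ℂ :=
  leftShift (fun i => τ.rowOf (Fin.castLE hk i)) (fun i => τ.colOf (Fin.castLE hk i))

theorem submatrix_shiftMatrix {k l : ℕ} (hk : k ≤ l) (hl : l ≤ μ.card) :
    (τ.shiftMatrix hl).submatrix (Fin.castLE hk) (Fin.castLE hk) =
      τ.shiftMatrix (hk.trans hl) :=
  rfl

theorem card_filter_colOf (c : ℕ) :
    (Finset.univ.filter fun i => τ.colOf i = c).card =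
      (μ.cells.filter fun x => x.2 = c).card := by
  refine Finset.card_bij (fun i _ => (τ.entry.symm i).1) (fun i hi => ?_) (fun i _ j _ h => ?_)
    fun x hx => ?_
  · exact Finset.mem_filter.2 ⟨(τ.entry.symm i).2, (Finset.mem_filter.1 hi).2⟩
  · exact τ.entry.symm.injective (Subtype.ext h)
  · obtain ⟨h1, h2⟩ := Finset.mem_filter.1 hx
    exact ⟨τ.entry ⟨x, h1⟩, Finset.mem_filter.2 ⟨Finset.mem_univ _, by simp [colOf, h2]⟩, by simp⟩

/-- The first `k` entries of a row-standard tableau need not fill a Young diagram, but they are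
left-justified in each row, so only the column counts matter. -/
theorem hasJordanType_shiftMatrix {k : ℕ} (hk : k ≤ μ.card) {ν : YoungDiagram}
    (hcount : ∀ c, (Finset.univ.filter fun i : Fin k => τ.colOf (Fin.castLE hk i) = c).card =
      (ν.cells.filter fun x => x.2 = c).card) :
    HasJordanType (toLin' (τ.shiftMatrix hk)) ν := by
  refine hasJordanType_leftShift (fun i j h h' => ?_) (fun i hi => ?_) hcount
  · exact Fin.castLE_injective hk (τ.eq_of_rowOf_eq h h')
  · obtain ⟨j, hj, h1, h2⟩ :=
      τ.exists_rowOf_colOf (Fin.castLE hk i) (c := τ.colOf (Fin.castLE hk i) - 1) (by omega)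
    have hj' : (j : ℕ) < i := hj
    exact ⟨⟨j, hj'.trans i.2⟩, h1,
      show τ.colOf j + 1 = τ.colOf (Fin.castLE hk i) by omega⟩

theorem hasJordanType_shiftMatrix_self :
    HasJordanType (toLin' (τ.shiftMatrix le_rfl)) μ :=
  τ.hasJordanType_shiftMatrix le_rfl τ.card_filter_colOf

theorem shiftMatrix_apply_eq_zero {k : ℕ} (hk : k ≤ μ.card) {i j : Fin k} (h : j ≤ i) :
    τ.shiftMatrix hk i j = 0 := by
  refine if_neg fun h' => ?_
  exact ((τ.lt_iff_colOf_lt h'.1).2 (Nat.lt_of_succ_le h'.2.le)).not_ge h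

/-- Adjacency in a row is expressed without columns, because `τ' ⊆ τ` only controls which entries
share a row. -/
theorem rowOf_eq_and_colOf_succ_iff {i j : Fin μ.card} :
    τ.rowOf i = τ.rowOf j ∧ τ.colOf i + 1 = τ.colOf j ↔
      τ.rowOf i = τ.rowOf j ∧ i < j ∧ ∀ l, i < l → l < j → τ.rowOf l ≠ τ.rowOf j := by
  refine and_congr_right fun h => ⟨fun h' => ⟨(τ.lt_iff_colOf_lt h).2 (by omega), ?_⟩, ?_⟩
  · intro l h1 h2 h3
    have := (τ.lt_iff_colOf_lt (h.trans h3.symm)).1 h1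
    have := (τ.lt_iff_colOf_lt h3).1 h2
    omega
  · rintro ⟨hlt, hne⟩
    have h1 := (τ.lt_iff_colOf_lt h).1 hlt
    by_contra h2
    obtain ⟨l, hl, h3, h4⟩ := τ.exists_rowOf_colOf j (c := τ.colOf i + 1) (by omega)
    exact hne l ((τ.lt_iff_colOf_lt (h.trans h3.symm)).2 (by omega)) hl h3

theorem IsSubtableau.shiftMatrix_eq {τ' : RowStandardTableau μ'} {τ : RowStandardTableau μ}
    (h : τ'.IsSubtableau τ) (hle : μ'.card ≤ μ.card) :
    τ'.shiftMatrix le_rfl = τ.shiftMatrix hle := by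
  obtain ⟨_, h⟩ := h
  ext i j
  refine if_congr ?_ rfl rfl
  change (τ'.rowOf i = τ'.rowOf j ∧ τ'.colOf i + 1 = τ'.colOf j) ↔ _
  rw [rowOf_eq_and_colOf_succ_iff, rowOf_eq_and_colOf_succ_iff, h]
  refine and_congr_right fun _ => and_congr Iff.rfl ⟨fun hl l h1 h2 => ?_, fun hl l h1 h2 => ?_⟩
  · have h2' : (l : ℕ) < j := h2
    have := hl ⟨l, h2'.trans j.2⟩ h1 h2
    rwa [Ne, h] at this
  · rw [Ne, h]
    exact hl (Fin.castLE hle l) h1 h2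

end RowStandardTableau

namespace StandardTableau

variable (T : StandardTableau μ)

theorem mem_shapeUpTo {i : ℕ} {c : ℕ × ℕ} :
    c ∈ (T.shapeUpTo i).cells ↔ ∃ h : c ∈ μ.cells, (T.entry ⟨c, h⟩ : ℕ) < i := by
  simp only [shapeUpTo, Finset.mem_map, Finset.mem_filter, Finset.mem_univ, true_and,
    Function.Embedding.subtype_apply, Subtype.exists, exists_and_right, exists_eq_right]

theorem shapeUpTo_card : T.shapeUpTo μ.card = μ := by
  refine YoungDiagram.ext (Finset.ext fun c => ?_)
  rw [T.mem_shapeUpTo]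
  exact ⟨fun h => h.1, fun h => ⟨h, Fin.is_lt _⟩⟩

variable {T} {T' : StandardTableau μ'}

theorem IsSubtableau.shapeUpTo_eq (h : T'.IsSubtableau T) {i : ℕ} (hi : i ≤ μ'.card) :
    T'.shapeUpTo i = T.shapeUpTo i := by
  obtain ⟨m, h1, h2⟩ := h
  -- The cutoff `m` may exceed the number of boxes of `T`, so equality can fail.
  have hm : μ'.card ≤ m := by
    by_contra hlt
    push Not at hlt
    have h3 := ((h1 _).1 (T'.entry.symm ⟨m, hlt⟩).2)
    have h4 := h2 _ (T'.entry.symm ⟨m, hlt⟩).2 h3.1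
    have h5 := h3.2
    rw [← h4] at h5
    simp at h5
  refine YoungDiagram.ext (Finset.ext fun c => ?_)
  rw [T'.mem_shapeUpTo, T.mem_shapeUpTo]
  refine ⟨fun ⟨h3, h4⟩ => ?_, fun ⟨h3, h4⟩ => ?_⟩
  · obtain ⟨h5, _⟩ := (h1 c).1 h3
    exact ⟨h5, by rwa [← h2 c h3 h5]⟩
  · have h5 := (h1 c).2 ⟨h3, by omega⟩
    exact ⟨h5, by rwa [h2 c h5 h3]⟩

theorem card_filter_shapeUpTo (T : StandardTableau μ) (k c : ℕ) :
    ((T.shapeUpTo k).cells.filter fun x => x.2 = c).card =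
      (Finset.univ.filter fun i : Fin μ.card => (i : ℕ) < k ∧ T.colOf i = c).card := by
  symm
  refine Finset.card_bij (fun i _ => (T.entry.symm i).1) (fun i hi => ?_) (fun i _ j _ h => ?_)
    fun x hx => ?_
  · simp only [Finset.mem_filter, Finset.mem_univ, true_and] at hi
    exact Finset.mem_filter.2 ⟨T.mem_shapeUpTo.2 ⟨(T.entry.symm i).2, by simpa using hi.1⟩, hi.2⟩
  · exact T.entry.symm.injective (Subtype.ext h)
  · obtain ⟨h1, h2⟩ := Finset.mem_filter.1 hx
    obtain ⟨h3, h4⟩ := T.mem_shapeUpTo.1 h1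
    exact ⟨T.entry ⟨x, h3⟩, Finset.mem_filter.2 ⟨Finset.mem_univ _, h4,
      by simp [RowStandardTableau.colOf, h2]⟩, by simp⟩

end StandardTableau

/-- If the entries from `k` on lie in the same columns of `τ` and of `T`, then the shift matrix of
the first `k` entries of `τ` has the shape of the first `k` entries of `T` as Jordan type. -/
theorem hasJordanType_shiftMatrix_shapeUpTo (τ : RowStandardTableau μ) (T : StandardTableau μ)
    {k : ℕ} (hk : k ≤ μ.card) (h : ∀ i : Fin μ.card, k ≤ (i : ℕ) → τ.colOf i = T.colOf i) :
    HasJordanType (toLin' (τ.shiftMatrix hk)) (T.shapeUpTo k) := by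
  refine τ.hasJordanType_shiftMatrix hk fun c => ?_
  have h1 : (Finset.univ.filter fun i : Fin k => τ.colOf (Fin.castLE hk i) = c).card =
      (Finset.univ.filter fun i : Fin μ.card => (i : ℕ) < k ∧ τ.colOf i = c).card := by
    refine Finset.card_bij (fun i _ => Fin.castLE hk i) (fun i hi => ?_)
      (fun i _ j _ h => Fin.castLE_injective hk h) fun i hi => ?_
    · simpa using hi
    · simp only [Finset.mem_filter, Finset.mem_univ, true_and] at hi
      exact ⟨⟨i, hi.1⟩, by simpa using hi.2, rfl⟩
  -- Each column of `μ` splits into early and late entries. The late ones are equally many for `τ`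
  -- and `T`, hence so are the early ones.
  have key : ∀ σ : RowStandardTableau μ,
      (Finset.univ.filter fun i : Fin μ.card => (i : ℕ) < k ∧ σ.colOf i = c).card +
        (Finset.univ.filter fun i : Fin μ.card => ¬ (i : ℕ) < k ∧ σ.colOf i = c).card =
      (μ.cells.filter fun x => x.2 = c).card := by
    intro σ
    rw [← σ.card_filter_colOf,
      ← Finset.card_filter_add_card_filter_not (s := Finset.univ.filter fun i => σ.colOf i = c)
        (fun i : Fin μ.card => (i : ℕ) < k), Finset.filter_filter, Finset.filter_filter]
    simp only [and_comm]
  have h2 : (Finset.univ.filter fun i : Fin μ.card => ¬ (i : ℕ) < k ∧ τ.colOf i = c) =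
      Finset.univ.filter fun i : Fin μ.card => ¬ (i : ℕ) < k ∧ T.colOf i = c :=
    Finset.filter_congr fun i _ => and_congr_right fun hi => by rw [h i (not_lt.1 hi)]
  have h3 := key τ
  have h4 := key T.toRowStandardTableau
  rw [h2] at h3
  rw [h1, T.card_filter_shapeUpTo]
  omega

/-! ### Zariski closures of sets of complete flags -/

/-- The matrix whose columns are the vectors of a basis. -/
def basisMatrix {n : ℕ} (b : Module.Basis (Fin n) ℂ (Fin n → ℂ)) : Matrix (Fin n) (Fin n) ℂ :=
  Matrix.of fun i j => b j i

theorem basisMatrix_map {n : ℕ} (b : Module.Basis (Fin n) ℂ (Fin n → ℂ))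
    (φ : (Fin n → ℂ) ≃ₗ[ℂ] (Fin n → ℂ)) :
    basisMatrix (b.map φ) = LinearMap.toMatrix' φ.toLinearMap * basisMatrix b := by
  ext i j
  have : (LinearMap.toMatrix' φ.toLinearMap *ᵥ b j) i = φ (b j) i := by
    rw [LinearMap.toMatrix'_mulVec]
    rfl
  exact this.symm

theorem isUnit_det_basisMatrix {n : ℕ} (b : Module.Basis (Fin n) ℂ (Fin n → ℂ)) :
    IsUnit (basisMatrix b).det := by
  have h : basisMatrix b = (Pi.basisFun ℂ (Fin n)).toMatrix b := by
    ext i j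
    simp [basisMatrix, Module.Basis.toMatrix_apply]
  rw [h, ← Module.Basis.det_apply]
  exact Module.Basis.isUnit_det _ _

theorem exists_basisMatrix_eq {n : ℕ} {P : Matrix (Fin n) (Fin n) ℂ} (h : IsUnit P.det) :
    ∃ b, basisMatrix b = P := by
  have hli : LinearIndependent ℂ P.col :=
    Matrix.linearIndependent_cols_iff_isUnit.2 ((Matrix.isUnit_iff_isUnit_det _).2 h)
  refine ⟨basisOfLinearIndependentOfCardEqFinrank' _ hli (by simp), ?_⟩
  ext i j
  simp [basisMatrix]

theorem ofBasis_map_eq {n : ℕ} {b b' : Module.Basis (Fin n) ℂ (Fin n → ℂ)}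
    (h : CompleteFlag.ofBasis b = CompleteFlag.ofBasis b')
    (φ : (Fin n → ℂ) ≃ₗ[ℂ] (Fin n → ℂ)) :
    CompleteFlag.ofBasis (b.map φ) = CompleteFlag.ofBasis (b'.map φ) := by
  have key : ∀ (c : Module.Basis (Fin n) ℂ (Fin n → ℂ)) i,
      (CompleteFlag.ofBasis (c.map φ)).space i =
        ((CompleteFlag.ofBasis c).space i).map φ.toLinearMap := by
    intro c i
    change Submodule.span ℂ _ = (Submodule.span ℂ _).map _
    rw [Submodule.map_span, Set.image_image]
    rfl
  refine CompleteFlag.ext (funext fun i => ?_)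
  rw [key, key, h]

theorem isClosed_completeFlag_iff {n : ℕ} (Z : Set (CompleteFlag n)) :
    IsClosed Z ↔ ∃ S : Set (MatrixPolynomial n), ∀ b, CompleteFlag.ofBasis b ∈ Z ↔
      ∀ p ∈ S, evalAt (basisMatrix b) p = 0 := by
  rw [isClosed_coinduced]
  let _ := zariskiTopology (Fin n × Fin n)
  rw [isClosed_induced_iff]
  constructor
  · rintro ⟨t, ht, h⟩
    obtain ⟨S, rfl⟩ := (isClosed_zariskiTopology_iff t).1 ht
    exact ⟨S, fun b => (Set.ext_iff.1 h b).symm⟩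
  · rintro ⟨S, hS⟩
    exact ⟨_, (isClosed_zariskiTopology_iff _).2 ⟨S, rfl⟩, Set.ext fun b => (hS b).symm⟩

/-- The bases adapted to members of `X` form a set stable under the Borel subgroup, and so does the
closure of this set; it therefore descends to a closed set of flags. -/
theorem ofBasis_mem_closure_iff {n : ℕ} (X : Set (CompleteFlag n))
    (b : Module.Basis (Fin n) ℂ (Fin n → ℂ)) :
    CompleteFlag.ofBasis b ∈ closure X ↔
      basisMatrix b ∈ zariskiClosure (basisMatrix '' {b | CompleteFlag.ofBasis b ∈ X}) := by
  set Y := basisMatrix '' {b | CompleteFlag.ofBasis b ∈ X} with hY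
  constructor
  · intro hb
    have hstable : ∀ b c : Module.Basis (Fin n) ℂ (Fin n → ℂ),
        CompleteFlag.ofBasis b = CompleteFlag.ofBasis c → basisMatrix b ∈ zariskiClosure Y →
        basisMatrix c ∈ zariskiClosure Y := by
      intro b c hbc hb
      let t := (basisMatrix b)⁻¹ * basisMatrix c
      have ht : ∀ M : Matrix (Fin n) (Fin n) ℂ,
          Matrix.map (mvPolynomialX (Fin n) (Fin n) ℂ *
            t.map (MvPolynomial.C (σ := Fin n × Fin n))) (evalAt M) = M * t := fun M => by
        rw [Matrix.map_mul, map_evalAt_mvPolynomialX, map_evalAt_map_C]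
      have h1 := map_mem_zariskiClosure (S' := Y)
        (mvPolynomialX (Fin n) (Fin n) ℂ * t.map (MvPolynomial.C (σ := Fin n × Fin n))) 1
        (fun M hM _ => ?_) hb (by simp)
      · rwa [ht, ← Matrix.mul_assoc, Matrix.mul_nonsing_inv _ (isUnit_det_basisMatrix b),
          Matrix.one_mul] at h1
      · obtain ⟨d, hd, rfl⟩ := hM
        -- The automorphism taking `b` to `d` takes `c` to the basis of matrix `M * t`. As `b` and
        -- `c` span the same flag, so do their images.
        let φ := b.equiv d (Equiv.refl _)
        have hφ : b.map φ = d := by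
          refine Module.Basis.eq_of_apply_eq fun i => ?_
          simp [φ]
        refine ⟨c.map φ, ?_, ?_⟩
        · have := ofBasis_map_eq hbc φ
          rw [hφ] at this
          change CompleteFlag.ofBasis (c.map φ) ∈ X
          rw [← this]
          exact hd
        · rw [ht, basisMatrix_map, ← hφ, basisMatrix_map, Matrix.mul_assoc,
            ← Matrix.mul_assoc _ _ (basisMatrix c), Matrix.mul_nonsing_inv _ (isUnit_det_basisMatrix b), Matrix.one_mul]
    let Z : Set (CompleteFlag n) :=
      {F | ∀ b, CompleteFlag.ofBasis b = F → basisMatrix b ∈ zariskiClosure Y}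
    have hZ : IsClosed Z := by
      refine (isClosed_completeFlag_iff Z).2 ⟨{p | ∀ M ∈ Y, evalAt M p = 0}, fun b => ?_⟩
      exact ⟨fun h => h b rfl, fun h c hc => hstable b c hc.symm h⟩
    have hXZ : X ⊆ Z := by
      rintro _ hF b rfl p hp
      exact hp _ ⟨b, hF, rfl⟩
    exact closure_minimal hXZ hZ hb b rfl
  · rintro hb Z ⟨hZ, hXZ⟩
    obtain ⟨S, hS⟩ := (isClosed_completeFlag_iff Z).1 hZ
    refine (hS b).2 fun p hp => hb p ?_
    rintro _ ⟨c, hc, rfl⟩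
    exact (hS c).1 (hXZ hc) p hp

/-! ### Matrices adapted to a standard tableau -/

/-- The upper triangular `k × k` matrices such that for all `i` the Jordan type of the leading
`i × i` block is the shape of the first `i` entries of `T`. -/
def adaptedMatrices (T : StandardTableau μ) (k : ℕ) : Set (Matrix (Fin k) (Fin k) ℂ) :=
  {A | (∀ i j, j < i → A i j = 0) ∧ ∀ (i : ℕ) (h : i ≤ k),
    HasJordanType (toLin' (A.submatrix (Fin.castLE h) (Fin.castLE h))) (T.shapeUpTo i)}

theorem hasJordanType_of_mem_adaptedMatrices {T : StandardTableau μ} {k : ℕ}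
    {A : Matrix (Fin k) (Fin k) ℂ} (h : A ∈ adaptedMatrices T k) :
    HasJordanType (toLin' A) (T.shapeUpTo k) :=
  h.2 k le_rfl

theorem adaptedMatrices_eq_of_isSubtableau {T' : StandardTableau μ'} {T : StandardTableau μ}
    (h : T'.IsSubtableau T) : adaptedMatrices T' μ'.card = adaptedMatrices T μ'.card := by
  ext A
  refine and_congr_right fun _ => forall_congr' fun i => forall_congr' fun hi => ?_
  rw [h.shapeUpTo_eq hi]

theorem submatrix_mem_adaptedMatrices {T : StandardTableau μ} {k l : ℕ} (h : k ≤ l)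
    {A : Matrix (Fin l) (Fin l) ℂ} (hA : A ∈ adaptedMatrices T l) :
    A.submatrix (Fin.castLE h) (Fin.castLE h) ∈ adaptedMatrices T k :=
  ⟨fun _ _ hij => hA.1 _ _ hij, fun i hi => hA.2 i (hi.trans h)⟩

/-- Dividing the vectors of column `j` by `a ^ j` restores the Jordan relations. This absorbs the
determinants that appear when adjugates replace inverses. -/
theorem HasJordanType.smul {V : Type*} [AddCommGroup V] [Module ℂ V] {u : Module.End ℂ V}
    (h : HasJordanType u μ) {a : ℂ} (ha : a ≠ 0) : HasJordanType (a • u) μ := by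
  obtain ⟨e, he⟩ := h
  refine ⟨e.unitsSMul fun c => (Units.mk0 a ha)⁻¹ ^ c.1.2, fun c hc => ?_, fun c c' h1 h2 => ?_⟩
  · simp [Module.Basis.unitsSMul_apply, Units.smul_def, he.1 c hc]
  · simp only [Module.Basis.unitsSMul_apply, Units.smul_def, LinearMap.smul_apply, map_smul,
      he.2 c c' h1 h2, smul_smul]
    congr 1
    rw [← h2]
    simp only [Units.val_pow_eq_pow_val, Units.val_inv_eq_inv_val, Units.val_mk0]
    rw [pow_succ, mul_assoc, inv_mul_cancel₀ ha, mul_one]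

theorem smul_mem_adaptedMatrices {T : StandardTableau μ} {k : ℕ}
    {A : Matrix (Fin k) (Fin k) ℂ} (h : A ∈ adaptedMatrices T k) {a : ℂ} (ha : a ≠ 0) :
    a • A ∈ adaptedMatrices T k := by
  refine ⟨fun i j hij => by simp [h.1 i j hij], fun i hi => ?_⟩
  have := (h.2 i hi).smul ha
  rwa [← map_smul] at this

theorem toMatrix'_mul_basisMatrix {n : ℕ} (u : Module.End ℂ (Fin n → ℂ))
    (b : Module.Basis (Fin n) ℂ (Fin n → ℂ)) :
    LinearMap.toMatrix' u * basisMatrix b = basisMatrix b * LinearMap.toMatrix b b u := by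
  ext i j
  have h1 : (LinearMap.toMatrix' u * basisMatrix b) i j = u (b j) i := by
    have : (LinearMap.toMatrix' u *ᵥ b j) i = u (b j) i := by rw [LinearMap.toMatrix'_mulVec]
    exact this
  rw [h1]
  conv_lhs => rw [← b.sum_repr (u (b j))]
  simp [Matrix.mul_apply, basisMatrix, LinearMap.toMatrix_apply, mul_comm]

theorem mem_flag_iff {n : ℕ} (b : Module.Basis (Fin n) ℂ (Fin n → ℂ)) (i : Fin (n + 1))
    (x : Fin n → ℂ) :
    x ∈ (CompleteFlag.ofBasis b).space i ↔ ∀ j : Fin n, (i : ℕ) ≤ j → b.repr x j = 0 := by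
  change x ∈ Submodule.span ℂ (b '' _) ↔ _
  rw [Module.Basis.mem_span_image]
  refine ⟨fun h j hj => ?_, fun h j hj => ?_⟩
  · by_contra h0
    have h1 : (j : ℕ) < i := h (Finset.mem_coe.2 (Finsupp.mem_support_iff.2 h0))
    omega
  · by_contra h0
    exact Finsupp.mem_support_iff.1 (Finset.mem_coe.1 hj)
      (h j (not_lt.1 fun h1 => h0 (show (j : ℕ) < i from h1)))

theorem ofBasis_mem_springerFiber_iff {n : ℕ} (u : Module.End ℂ (Fin n → ℂ))
    (b : Module.Basis (Fin n) ℂ (Fin n → ℂ)) :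
    CompleteFlag.ofBasis b ∈ springerFiber u ↔
      ∀ i j, j < i → LinearMap.toMatrix b b u i j = 0 := by
  refine ⟨fun h i j hij => ?_, fun h i x hx => ?_⟩
  · rw [LinearMap.toMatrix_apply]
    refine (mem_flag_iff b j.succ _).1 (h j.succ (b j) ((mem_flag_iff b _ _).2 fun l hl => ?_)) i
      (by rw [Fin.val_succ]; exact hij)
    rw [Fin.val_succ] at hl
    rw [b.repr_self, Finsupp.single_apply, if_neg]
    rintro rfl
    omega
  · rw [mem_flag_iff] at hx ⊢
    intro j hj
    rw [← LinearMap.toMatrix_mulVec_repr b b]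
    change ∑ l, LinearMap.toMatrix b b u j l * b.repr x l = 0
    refine Finset.sum_eq_zero fun l _ => ?_
    rcases lt_or_ge l j with hl | hl
    · rw [h j l hl, zero_mul]
    · rw [hx l (hj.trans hl), mul_zero]

/-- The coordinates of the vectors of the `i`-th space of a flag in an adapted basis. -/
theorem exists_coordinates {n : ℕ} {u : Module.End ℂ (Fin n → ℂ)}
    {b : Module.Basis (Fin n) ℂ (Fin n → ℂ)} (hb : CompleteFlag.ofBasis b ∈ springerFiber u)
    (i : Fin (n + 1)) :
    ∃ φ : (CompleteFlag.ofBasis b).space i ≃ₗ[ℂ] (Fin i → ℂ), ∀ x,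
      toLin' ((LinearMap.toMatrix b b u).submatrix (Fin.castLE (Nat.lt_succ_iff.1 i.2))
        (Fin.castLE (Nat.lt_succ_iff.1 i.2))) (φ x) = φ (u.restrict (hb i) x) := by
  have hi : (i : ℕ) ≤ n := Nat.lt_succ_iff.1 i.2
  let f : (CompleteFlag.ofBasis b).space i →ₗ[ℂ] (Fin i → ℂ) :=
    LinearMap.funLeft ℂ ℂ (Fin.castLE hi) ∘ₗ b.equivFun.toLinearMap ∘ₗ Submodule.subtype _
  have hf : ∀ x j, f x j = b.repr x (Fin.castLE hi j) := fun x j => rfl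
  have hinj : Function.Injective f := by
    rw [← LinearMap.ker_eq_bot, LinearMap.ker_eq_bot']
    intro x hx
    refine Subtype.ext (b.ext_elem fun j => ?_)
    rw [ZeroMemClass.coe_zero, map_zero, Finsupp.zero_apply]
    rcases lt_or_ge (j : ℕ) i with hj | hj
    · exact congrFun hx ⟨j, hj⟩
    · exact (mem_flag_iff b i x).1 x.2 j hj
  refine ⟨LinearMap.linearEquivOfInjective f hinj ?_, fun x => ?_⟩
  · rw [CompleteFlag.finrank_eq]
    simp
  · ext j
    rw [LinearMap.linearEquivOfInjective_apply, LinearMap.linearEquivOfInjective_apply, hf,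
      LinearMap.coe_restrict_apply, ← LinearMap.toMatrix_mulVec_repr b b]
    refine Fintype.sum_of_injective (Fin.castLE hi) (Fin.castLE_injective hi) _ _ (fun l hl => ?_)
      fun l => rfl
    rw [(mem_flag_iff b i x).1 x.2 l (not_lt.1 fun h => hl ⟨⟨l, h⟩, rfl⟩), mul_zero]

theorem ofBasis_mem_spaltensteinSet_iff {n : ℕ} (u : Module.End ℂ (Fin n → ℂ))
    (T : StandardTableau μ) (b : Module.Basis (Fin n) ℂ (Fin n → ℂ)) :
    CompleteFlag.ofBasis b ∈ spaltensteinSet u T ↔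
      LinearMap.toMatrix b b u ∈ adaptedMatrices T n := by
  constructor
  · rintro ⟨hF, h⟩
    refine ⟨(ofBasis_mem_springerFiber_iff u b).1 hF, fun i hi => ?_⟩
    obtain ⟨φ, hφ⟩ := exists_coordinates hF ⟨i, Nat.lt_succ_of_le hi⟩
    exact (h ⟨i, Nat.lt_succ_of_le hi⟩).map φ hφ
  · rintro ⟨h1, h2⟩
    have hF := (ofBasis_mem_springerFiber_iff u b).2 h1
    refine ⟨hF, fun i => ?_⟩
    obtain ⟨φ, hφ⟩ := exists_coordinates hF i
    refine (h2 i (Nat.lt_succ_iff.1 i.2)).map φ.symm fun x => φ.injective ?_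
    rw [← hφ, φ.apply_symm_apply, φ.apply_symm_apply]

/-! ### A matrix criterion for `τ ∈ T` -/

theorem IsJordanBasis.toMatrix_reindex {τ : RowStandardTableau μ}
    {u : Module.End ℂ (Fin μ.card → ℂ)} {e : Module.Basis μ.cells ℂ (Fin μ.card → ℂ)}
    (he : IsJordanBasis u e) :
    LinearMap.toMatrix (e.reindex τ.entry) (e.reindex τ.entry) u = τ.shiftMatrix le_rfl := by
  ext i j
  rw [LinearMap.toMatrix_apply, Module.Basis.reindex_apply]
  change _ = if τ.rowOf i = τ.rowOf j ∧ τ.colOf i + 1 = τ.colOf j then (1 : ℂ) else 0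
  rcases Nat.eq_zero_or_pos (τ.colOf j) with h0 | h0
  · rw [he.1 _ h0, if_neg (by omega)]
    simp
  · obtain ⟨l, -, h1, h2⟩ := τ.exists_rowOf_colOf j (c := τ.colOf j - 1) (by omega)
    have h3 : (τ.rowOf i = τ.rowOf j ∧ τ.colOf i + 1 = τ.colOf j) ↔ l = i :=
      ⟨fun h => τ.eq_of_rowOf_eq (by omega) (by omega), fun h => by subst h; omega⟩
    rw [he.2 _ (τ.entry.symm l) h1 (show τ.colOf l + 1 = τ.colOf j by omega)]
    simp [h3, Finsupp.single_apply]

theorem exists_isJordanBasis {V : Type*} [AddCommGroup V] [Module ℂ V]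
    (e : Module.Basis μ.cells ℂ V) : ∃ u : Module.End ℂ V, IsJordanBasis u e := by
  classical
  refine ⟨e.constr ℂ fun c => if h : c.1.2 = 0 then 0 else
    e ⟨(c.1.1, c.1.2 - 1), μ.isLowerSet
      (show (c.1.1, c.1.2 - 1) ≤ c.1 from ⟨le_rfl, Nat.sub_le _ _⟩) c.2⟩,
    fun c hc => ?_, fun c c' h1 h2 => ?_⟩
  · rw [Module.Basis.constr_basis, dif_pos hc]
  · rw [Module.Basis.constr_basis, dif_neg (by omega)]
    exact congrArg e (Subtype.ext (Prod.ext h1.symm (show c.1.2 - 1 = c'.1.2 by omega)))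

/-- One direction pushes closures along `g ↦ g⁻¹ u g`, from bases to matrices; the other uses a
local section of this map through the shift matrix of `τ`, provided by the conjugating family. -/
theorem inComponent_iff (τ : RowStandardTableau μ) (T : StandardTableau μ) :
    τ.InComponent T ↔ τ.shiftMatrix le_rfl ∈ zariskiClosure (adaptedMatrices T μ.card) := by
  constructor
  · intro h
    let e : Module.Basis μ.cells ℂ (Fin μ.card → ℂ) :=
      (Pi.basisFun ℂ (Fin μ.card)).reindex τ.entry.symm
    obtain ⟨u, he⟩ := exists_isJordanBasis e
    have h1 := (ofBasis_mem_closure_iff _ _).1 (h u e he).2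
    let b := e.reindex τ.entry
    let U : Matrix (Fin μ.card) (Fin μ.card) (MatrixPolynomial μ.card) :=
      (LinearMap.toMatrix' u).map (MvPolynomial.C (σ := Fin μ.card × Fin μ.card))
    let X := mvPolynomialX (Fin μ.card) (Fin μ.card) ℂ
    have hΦ : ∀ c : Module.Basis (Fin μ.card) ℂ (Fin μ.card → ℂ),
        (X.adjugate * (U * X)).map (evalAt (basisMatrix c)) =
          (basisMatrix c).det • LinearMap.toMatrix c c u := fun c => by
      rw [Matrix.map_mul, Matrix.map_mul, map_evalAt_adjugate, map_evalAt_mvPolynomialX,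
        map_evalAt_map_C, toMatrix'_mul_basisMatrix, ← Matrix.mul_assoc, adjugate_mul,
        Matrix.smul_mul, Matrix.one_mul]
    -- The adjugate keeps the map polynomial at the cost of a determinant, removed below by a
    -- constant rescaling.
    have h2 := map_mem_zariskiClosure (S' := adaptedMatrices T μ.card)
      (X.adjugate * (U * X)) 1 (fun M hM _ => ?_) h1 (by simp)
    · have hb : (basisMatrix b).det ≠ 0 := (isUnit_det_basisMatrix b).ne_zero
      let a := (basisMatrix b).det⁻¹
      have hΨ : ∀ M : Matrix (Fin μ.card) (Fin μ.card) ℂ,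
          ((MvPolynomial.C a : MatrixPolynomial μ.card) • X).map (evalAt M) = a • M := fun M => by
        ext i j
        simp [X, evalAt]
      have h3 := map_mem_zariskiClosure (S' := adaptedMatrices T μ.card)
        ((MvPolynomial.C a : MatrixPolynomial μ.card) • X) 1 (fun M hM _ => by
          rw [hΨ]
          exact smul_mem_adaptedMatrices hM (inv_ne_zero hb)) h2 (by simp)
      rw [hΨ, hΦ, smul_smul, inv_mul_cancel₀ hb, one_smul, he.toMatrix_reindex] at h3
      exact h3
    · obtain ⟨c, hc, rfl⟩ := hM
      rw [hΦ]
      exact smul_mem_adaptedMatrices ((ofBasis_mem_spaltensteinSet_iff u T c).1 hc)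
        (isUnit_det_basisMatrix c).ne_zero
  · intro h u e he
    let b := e.reindex τ.entry
    have hb : LinearMap.toMatrix b b u = τ.shiftMatrix le_rfl := he.toMatrix_reindex
    refine ⟨(ofBasis_mem_springerFiber_iff u b).2 fun i j hij => ?_,
      (ofBasis_mem_closure_iff _ b).2 ?_⟩
    · rw [hb, τ.shiftMatrix_apply_eq_zero le_rfl hij.le]
    · obtain ⟨G, hG1, hG⟩ := exists_conjugating_section τ.hasJordanType_shiftMatrix_self
      -- The local section is `A ↦ B * adj(G(A))`: it sends the shift matrix to `B`, and a nearby
      -- adapted `A` to a basis in which `u` has matrix `A`.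
      let B : Matrix (Fin μ.card) (Fin μ.card) (MatrixPolynomial μ.card) :=
        (basisMatrix b).map (MvPolynomial.C (σ := Fin μ.card × Fin μ.card))
      have hΦ : ∀ A, (B * G.adjugate).map (evalAt A) =
          basisMatrix b * (G.map (evalAt A)).adjugate := fun A => by
        rw [Matrix.map_mul, map_evalAt_map_C, map_evalAt_adjugate]
      have h1 := map_mem_zariskiClosure
        (S' := basisMatrix '' {b | CompleteFlag.ofBasis b ∈ spaltensteinSet u T})
        (B * G.adjugate) G.det (fun M hM hdet => ?_) h (by rw [evalAt_det, hG1]; simp)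
      · rwa [hΦ, hG1, adjugate_one, Matrix.mul_one] at h1
      · rw [evalAt_det] at hdet
        rw [hΦ]
        have hM' := hG M (by
          have := hasJordanType_of_mem_adaptedMatrices hM
          rwa [T.shapeUpTo_card] at this)
        set g := G.map (evalAt M)
        have hg : IsUnit (basisMatrix b * g.adjugate).det := by
          rw [det_mul, det_adjugate]
          exact (isUnit_det_basisMatrix b).mul (hdet.isUnit.pow _)
        obtain ⟨c, hc⟩ := exists_basisMatrix_eq hg
        refine ⟨c, (ofBasis_mem_spaltensteinSet_iff u T c).2 ?_, hc⟩
        have h2 : τ.shiftMatrix le_rfl * g.adjugate = g.adjugate * M := by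
          have h3 : g.adjugate * (M * g) * g.adjugate = g.adjugate * (g * τ.shiftMatrix le_rfl) *
            g.adjugate := by rw [hM']
          rw [← Matrix.mul_assoc, ← Matrix.mul_assoc, adjugate_mul, Matrix.mul_assoc,
            mul_adjugate, Matrix.mul_smul, Matrix.mul_one, Matrix.smul_mul, Matrix.smul_mul,
            Matrix.one_mul] at h3
          exact (smul_right_injective _ hdet h3).symm
        have h4 : basisMatrix c * LinearMap.toMatrix c c u = basisMatrix c * M := by
          rw [← toMatrix'_mul_basisMatrix, hc, ← Matrix.mul_assoc, toMatrix'_mul_basisMatrix, hb,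
            Matrix.mul_assoc, h2, Matrix.mul_assoc]
        have h5 : LinearMap.toMatrix c c u = M := by
          have := congrArg (fun N => (basisMatrix c)⁻¹ * N) h4
          simpa only [← Matrix.mul_assoc, Matrix.nonsing_inv_mul _ (isUnit_det_basisMatrix c),
            Matrix.one_mul] using this
        rwa [h5]

/-! ### Adding an entry to the tableaux -/

/-- The matrix `B` with a column `v` added on the right and a row `(0, …, 0, a)` added below. -/
def border {R : Type*} [Zero R] {k : ℕ} (B : Matrix (Fin k) (Fin k) R) (v : Fin k → R) (a : R) :
    Matrix (Fin (k + 1)) (Fin (k + 1)) R :=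
  Matrix.of fun i j => Fin.lastCases (motive := fun _ => R)
    (Fin.lastCases (motive := fun _ => R) a (fun _ => 0) j)
    (fun i' => Fin.lastCases (motive := fun _ => R) (v i') (fun j' => B i' j') j) i

section border

variable {R : Type*} {k : ℕ}

@[simp]
theorem border_castSucc_castSucc [Zero R] (B : Matrix (Fin k) (Fin k) R) (v : Fin k → R) (a : R)
    (i j : Fin k) : border B v a i.castSucc j.castSucc = B i j := by
  simp [border]

@[simp]
theorem border_castSucc_last [Zero R] (B : Matrix (Fin k) (Fin k) R) (v : Fin k → R) (a : R)
    (i : Fin k) : border B v a i.castSucc (Fin.last k) = v i := by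
  simp [border]

@[simp]
theorem border_last_castSucc [Zero R] (B : Matrix (Fin k) (Fin k) R) (v : Fin k → R) (a : R)
    (j : Fin k) : border B v a (Fin.last k) j.castSucc = 0 := by
  simp [border]

@[simp]
theorem border_last_last [Zero R] (B : Matrix (Fin k) (Fin k) R) (v : Fin k → R) (a : R) :
    border B v a (Fin.last k) (Fin.last k) = a := by
  simp [border]

theorem border_mul [CommSemiring R] (B B' : Matrix (Fin k) (Fin k) R) (v v' : Fin k → R)
    (a a' : R) :
    border B v a * border B' v' a' = border (B * B') (B *ᵥ v' + a' • v) (a * a') := by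
  ext i j
  refine Fin.lastCases ?_ (fun i => ?_) i <;> refine Fin.lastCases ?_ (fun j => ?_) j <;>
    simp [Matrix.mul_apply, Fin.sum_univ_castSucc, Matrix.mulVec, dotProduct, mul_comm]

theorem border_one [CommSemiring R] : border (1 : Matrix (Fin k) (Fin k) R) 0 1 = 1 := by
  ext i j
  refine Fin.lastCases ?_ (fun i => ?_) i <;> refine Fin.lastCases ?_ (fun j => ?_) j <;>
    simp [Matrix.one_apply, Fin.castSucc_ne_last, (Fin.castSucc_ne_last _).symm]

theorem map_border [CommSemiring R] {S : Type*} [CommSemiring S] (f : R →+* S)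
    (B : Matrix (Fin k) (Fin k) R) (v : Fin k → R) (a : R) :
    (border B v a).map f = border (B.map f) (f ∘ v) (f a) := by
  ext i j
  refine Fin.lastCases ?_ (fun i => ?_) i <;> refine Fin.lastCases ?_ (fun j => ?_) j <;> simp

end border

theorem HasJordanType.of_mul_eq {n : ℕ} {A B P : Matrix (Fin n) (Fin n) ℂ}
    (hB : HasJordanType (toLin' B) μ) (hP : IsUnit P.det) (h : A * P = P * B) :
    HasJordanType (toLin' A) μ := by
  refine hB.map (Matrix.toLinearEquiv' P ((P.invertibleOfIsUnitDet hP))) fun x => ?_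
  change A *ᵥ (P *ᵥ x) = P *ᵥ (B *ᵥ x)
  rw [mulVec_mulVec, mulVec_mulVec, h]

/-- The smaller leading blocks are those of `B`, so only the full matrix brings a new condition. -/
theorem border_mem_adaptedMatrices {T : StandardTableau μ} {k : ℕ}
    {B : Matrix (Fin k) (Fin k) ℂ} (hB : B ∈ adaptedMatrices T k) {v : Fin k → ℂ} {a : ℂ}
    (h : HasJordanType (toLin' (border B v a)) (T.shapeUpTo (k + 1))) :
    border B v a ∈ adaptedMatrices T (k + 1) := by
  refine ⟨fun i j hij => ?_, fun i hi => ?_⟩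
  · induction j using Fin.lastCases with
    | last => exact ((Fin.le_last i).not_gt hij).elim
    | cast j =>
      induction i using Fin.lastCases with
      | last => simp
      | cast i => simpa using hB.1 i j hij
  · rcases Nat.lt_or_eq_of_le hi with hlt | rfl
    · have h1 : (border B v a).submatrix (Fin.castLE hi) (Fin.castLE hi) =
          B.submatrix (Fin.castLE (Nat.lt_succ_iff.1 hlt))
            (Fin.castLE (Nat.lt_succ_iff.1 hlt)) := by
        ext p q
        exact border_castSucc_castSucc B v a (Fin.castLE (Nat.lt_succ_iff.1 hlt) p)
          (Fin.castLE (Nat.lt_succ_iff.1 hlt) q)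
      rw [h1]
      exact hB.2 i _
    · exact h

theorem shiftMatrix_succ_mem_zariskiClosure {τ : RowStandardTableau μ} {T : StandardTableau μ}
    {k : ℕ} (hk : k + 1 ≤ μ.card) (hcol : ∀ i : Fin μ.card, k ≤ (i : ℕ) → τ.colOf i = T.colOf i)
    (h : τ.shiftMatrix ((Nat.le_succ k).trans hk) ∈ zariskiClosure (adaptedMatrices T k)) :
    τ.shiftMatrix hk ∈ zariskiClosure (adaptedMatrices T (k + 1)) := by
  have hk' : k ≤ μ.card := (Nat.le_succ k).trans hk
  let v : Fin k → ℂ := fun i => τ.shiftMatrix hk i.castSucc (Fin.last k)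
  have hborder : τ.shiftMatrix hk = border (τ.shiftMatrix hk') v 0 := by
    ext i j
    refine Fin.lastCases ?_ (fun i => ?_) i
    · rw [τ.shiftMatrix_apply_eq_zero hk (Fin.le_last j)]
      refine Fin.lastCases ?_ (fun j => ?_) j <;> simp
    · refine Fin.lastCases ?_ (fun j => ?_) j
      · simp [v]
      · rw [border_castSucc_castSucc]
        rfl
  obtain ⟨G, hG1, hG⟩ := exists_conjugating_section
    (hasJordanType_shiftMatrix_shapeUpTo τ T hk' hcol)
  have hsucc := hasJordanType_shiftMatrix_shapeUpTo τ T hk fun i hi => hcol i (by omega)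
  -- With this border, the block matrix with diagonal blocks `G(A)` and `1` intertwines the bordered
  -- `A` with the next shift matrix.
  let w : Fin k → MatrixPolynomial k := G *ᵥ (MvPolynomial.C ∘ v)
  have hw : ∀ A, evalAt A ∘ w = G.map (evalAt A) *ᵥ v := fun A => by
    ext i
    have : evalAt A ∘ (MvPolynomial.C (σ := Fin k × Fin k) ∘ v) = v := by
      ext
      simp
    rw [Function.comp_apply, RingHom.map_mulVec, this]
  have hΦ : ∀ A, (border (mvPolynomialX (Fin k) (Fin k) ℂ) w 0).map (evalAt A) =
      border A (G.map (evalAt A) *ᵥ v) 0 := fun A => by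
    rw [map_border, map_evalAt_mvPolynomialX, hw, map_zero]
  have h1 := map_mem_zariskiClosure (S' := adaptedMatrices T (k + 1))
    (border (mvPolynomialX (Fin k) (Fin k) ℂ) w 0) G.det (fun A hA hdet => ?_) h
    (by rw [evalAt_det, hG1]; simp)
  · rwa [hΦ, hG1, one_mulVec, ← hborder] at h1
  · rw [evalAt_det] at hdet
    rw [hΦ]
    refine border_mem_adaptedMatrices hA (hsucc.of_mul_eq (P := border (G.map (evalAt A)) 0 1) ?_ ?_)
    · refine Matrix.isUnit_det_of_left_inverse (B := border (G.map (evalAt A))⁻¹ 0 1) ?_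
      rw [border_mul, Matrix.nonsing_inv_mul _ hdet.isUnit]
      simpa using border_one
    · rw [hborder, border_mul, border_mul, hG A (hasJordanType_of_mem_adaptedMatrices hA)]
      simp

end Springer
end

/-! ### Truncation and extension of adapted matrices -/

open Springer in
theorem mainTheorem6 {μ μ' : YoungDiagram}
    (τ : Springer.RowStandardTableau μ) (T : Springer.StandardTableau μ)
    (τ' : Springer.RowStandardTableau μ') (T' : Springer.StandardTableau μ')
    (hτ : τ'.IsSubtableau τ) (hT : T'.IsSubtableau T) :
    (τ.InComponent T → τ'.InComponent T') ∧
      ((∀ i : Fin μ.card, μ'.card ≤ (i : ℕ) → τ.colOf i = T.colOf i) →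
        (τ.InComponent T ↔ τ'.InComponent T')) := by
  have hle : μ'.card ≤ μ.card := hτ.1
  rw [inComponent_iff, inComponent_iff, hτ.shiftMatrix_eq hle,
    adaptedMatrices_eq_of_isSubtableau hT]
  have ha : τ.shiftMatrix le_rfl ∈ zariskiClosure (adaptedMatrices T μ.card) →
      τ.shiftMatrix hle ∈ zariskiClosure (adaptedMatrices T μ'.card) := by
    intro h
    have hΦ : ∀ A : Matrix (Fin μ.card) (Fin μ.card) ℂ,
        ((Matrix.mvPolynomialX (Fin μ.card) (Fin μ.card) ℂ).submatrix (Fin.castLE hle)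
          (Fin.castLE hle)).map (evalAt A) =
            A.submatrix (Fin.castLE hle) (Fin.castLE hle) := fun A => by
      rw [← Matrix.submatrix_map, map_evalAt_mvPolynomialX]
    have := map_mem_zariskiClosure (S' := adaptedMatrices T μ'.card) _ 1
      (fun A hA _ => by rw [hΦ]; exact submatrix_mem_adaptedMatrices hle hA) h (by simp)
    rwa [hΦ, τ.submatrix_shiftMatrix hle] at this
  refine ⟨ha, fun hcol => ⟨ha, fun h => ?_⟩⟩
  -- The entries of `τ` missing from `τ'` are restored one at a time; the column hypothesis applies
  -- at every stage.
  have key : ∀ k, μ'.card ≤ k → ∀ hk : k ≤ μ.card,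
      τ.shiftMatrix hk ∈ zariskiClosure (adaptedMatrices T k) := by
    intro k hk
    induction k, hk using Nat.le_induction with
    | base => exact fun _ => h
    | succ k hk ih =>
      exact fun hk' => shiftMatrix_succ_mem_zariskiClosure hk'
        (fun i hi => hcol i (hk.trans hi)) (ih _)
  exact key μ.card hle le_rfl
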